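/- Let $n\ge 3$, let $A=\mathrm{diag}(A_1,\dots,A_n)$ with all $A_i>0$, and let $I\subset\mathbb R$ be an open interval. Write $x\wedge y=xy^T-yx^T$ and $\langle X,Y\rangle=-\tfrac12\mathrm{tr}(XY)$ on $so(n)$, and let $\mathcal I:so(n)\to so(n)$ be the linear operator with $\mathcal I(E_i\wedge E_j)=\frac{A_iA_j}{\det A}E_i\wedge E_j$, where $E_1,\dots,E_n$ is the standard basis of $\mathbb R^n$. The (unreduced) Veselova LR system is the following system for $g(t)\in SO(n)$, $\omega=g^{-1}\dot g$, $e_i=g^{-1}E_i$ (so that $\dot e_i=-\omega e_i$): $$\langle\omega,e_a\wedge e_b\rangle=0\quad(2\le a<b\le n),\qquad \frac{d}{dt}(\mathcal I\omega)=[\mathcal I\omega,\omega]+\sum_{2\le a<b\le n}\lambda_{ab}\,e_a\wedge e_b ,$$ with Lagrange multipliers $\lambda_{ab}$. It projects by $q=e_1$, $p=\frac1{\det A}\big[(q,Aq)A\dot q-(\dot q,Aq)Aq\big]$ onto the reduced system on $T^*S^{n-1}=\{(q,q)=1,\ (q,p)=0\}$, $$\dot q=\frac{\det A}{(q,Aq)}\big[A^{-1}p-(p,A^{-1}q)q\big],\qquad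 \dot p=-\det A\,\frac{(p,A^{-1}p)-(p,q)(q,A^{-1}p)}{(q,Aq)}\,q .$$ Let $(q(t),p(t))$, $t\in I$, be a solution of the reduced system that is not an equilibrium ($p\ne0$ at some time). Put $X=(q,Aq)^{-1/2}Aq$, let $s$ be the arc length of the curve $X$, $\gamma=dX/ds$ its unit tangent, $\Pi_\gamma=\mathrm{Id}-\gamma\otimes\gamma$, and $\mathcal L=\Pi_\gamma(A-X\otimes X)\Pi_\gamma$. Let $Q(\alpha)=\{x\in\mathbb R^n:\sum_i x_i^2/(\alpha-A_i)=-1\}$ for $\alpha\notin\{A_1,\dots,A_n\}$. Then: 1. $X$ is a regular curve on $Q(0)$, and it is a geodesic of $Q(0)$ in the parameter $s$. The energy $h=\frac1{2\det A}\big[(A\dot q,\dot q)(Aq,q)-(Aq,\dot q)^2\big]$ is a positive constant, and $$\frac{ds}{dt}=\sqrt{\frac{(X,A^{-2}X)}{(\gamma,A^{-1}\gamma)}}\,\sqrt{\det A\,\frac{2h}{(Aq,q)}} .$$ 2. There are constants $\alpha_2,\dots,\alpha_{n-1}$ such that for all $t\in I$ the characteristic polynomial of $\mathcal L(t)$ is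 $z^2\prod_{k=2}^{n-1}(z-\alpha_k)$. There are unit vectors $\mathfrak n_k(t)$, $2\le k\le n-1$, continuous in $t$, with $\mathcal L\mathfrak n_k=\alpha_k\mathfrak n_k$ and $\det(q,\mathfrak n_2,\dots,\mathfrak n_{n-1},\gamma)>0$, such that the frame $$e_1=q(t),\quad e_2=\mathfrak n_2(t),\ \dots,\ e_{n-1}=\mathfrak n_{n-1}(t),\quad e_n=\gamma(t)$$ together with $\omega=q\wedge\dot q$ is a solution of the LR system (in particular the frame is orthonormal and positively oriented). 3. If the $\alpha_k$ are pairwise distinct (the generic case), then for every choice of continuous unit vectors $\mathfrak n_k$ with $\mathcal L\mathfrak n_k=\alpha_k\mathfrak n_k$ and $\det(q,\mathfrak n_2,\dots,\mathfrak n_{n-1},\gamma)>0$ this frame, with $\omega=q\wedge\dot q$, is a solution of the LR system. Moreover, whenever $\alpha_k\notin\{A_1,\dots,A_n\}$, at each time $t\in I$ the tangent line $\{X+\sigma\gamma\}$ touches the confocal quadric $Q(\alpha_k)$ (at a point that may be at infinity), and $\mathfrak n_k$ is normal to $Q(\alpha_k)$ at the touching point. (The normal at the point $[y:w]$ of the projective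 closure $\sum_i y_i^2/(\alpha-A_i)+w^2=0$ of $Q(\alpha)$ is the vector with components $y_i/(\alpha-A_i)$.) 4. Let $(q,\mathfrak n_2,\dots,\mathfrak n_{n-1},\gamma)$ be any frame formed with such $\mathfrak n_k$ (continuous unit vectors, $\mathcal L\mathfrak n_k=\alpha_k\mathfrak n_k$, positive determinant) that is a solution with $\omega=q\wedge\dot q$. The solutions of the LR system on $I$ that project onto $(q(t),p(t))$ are exactly those with $\omega=q\wedge\dot q$, $e_1=q$ and $$(e_2(t)\ \cdots\ e_n(t))=(\mathfrak n_2(t)\ \cdots\ \mathfrak n_{n-1}(t)\ \gamma(t))\,\mathfrak R$$ for a constant matrix $\mathfrak R\in SO(n-1)$. -/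

import Mathlib

open Matrix

noncomputable section

namespace Veselova

/-! Vectors of `ℝⁿ` are functions `Fin n → ℝ` with the scalar product `x ⬝ᵥ y`; a positive diagonal
matrix `A = diag (A₁, …, Aₙ)` is given by its entries `A : Fin n → ℝ`, so that the vector `A x` is the
pointwise product `A * x` and `A⁻¹ x` is `A⁻¹ * x`. Indices start at `0`. -/

/-- `x ∧ y = x yᵀ - y xᵀ`, an element of `so(n)`. -/
def wedge {n : ℕ} (x y : Fin n → ℝ) : Matrix (Fin n) (Fin n) ℝ :=
  vecMulVec x y - vecMulVec y x

/-- The Killing scalar product `⟨X, Y⟩ = -½ tr (X Y)` on `so(n)`. -/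
def killing {n : ℕ} (X Y : Matrix (Fin n) (Fin n) ℝ) : ℝ := -(1 / 2) * (X * Y).trace

/-- `det A` for `A = diag (A₁, …, Aₙ)`. -/
def detA {n : ℕ} (A : Fin n → ℝ) : ℝ := ∏ i, A i

/-- The inertia operator: the linear map with `E_i ∧ E_j ↦ (A_i A_j / det A) E_i ∧ E_j`. -/
def inertia {n : ℕ} (A : Fin n → ℝ) (ω : Matrix (Fin n) (Fin n) ℝ) : Matrix (Fin n) (Fin n) ℝ :=
  Matrix.of fun i j => A i * A j / detA A * ω i j

theorem inertia_wedge_basis {n : ℕ} (A : Fin n → ℝ) (i j : Fin n) :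
    inertia A (wedge (Pi.single i 1) (Pi.single j 1)) =
      (A i * A j / detA A) • wedge (Pi.single i 1) (Pi.single j 1) := by
  ext a b
  simp only [inertia, wedge, vecMulVec_apply, of_apply, Matrix.sub_apply, Matrix.smul_apply, smul_eq_mul,
    Pi.single_apply]
  split_ifs <;> subst_vars <;> ring

/-- Solutions `(g, ġ)`, `ω = g⁻¹ ġ`, over the time interval `I`, of the LR system on the
right-invariant distribution `D ⊂ T SO(n)`, `n = k + 1`, in the left trivialization. The vectors
`e_i = g⁻¹ E_i` are the rows `g t i` of the orthogonal matrix `g t`. -/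
structure IsLRSolution {k : ℕ} (A : Fin (k + 1) → ℝ) (I : Set ℝ)
    (g ω : ℝ → Matrix (Fin (k + 1)) (Fin (k + 1)) ℝ) : Prop where
  mem_SO : ∀ t ∈ I, g t ∈ specialOrthogonalGroup (Fin (k + 1)) ℝ
  /-- `ġ = g ω` -/
  kinematic : ∀ t ∈ I, ∀ i j, HasDerivAt (fun u => g u i j) ((g t * ω t) i j) t
  /-- `⟨ω, e_a ∧ e_b⟩ = 0` for all `a < b` different from the first index -/
  constraint : ∀ t ∈ I, ∀ a b : Fin k, a < b →
    killing (ω t) (wedge (g t a.succ) (g t b.succ)) = 0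
  /-- `d/dt (𝓘 ω) = [𝓘 ω, ω] + ∑ λ_ab e_a ∧ e_b` with Lagrange multipliers `λ_ab` -/
  dynamic : ∀ t ∈ I, ∃ lam : Fin k → Fin k → ℝ, ∀ i j,
    HasDerivAt (fun u => inertia A (ω u) i j)
      ((inertia A (ω t) * ω t - ω t * inertia A (ω t) +
        ∑ a, ∑ b ∈ Finset.Ioi a, lam a b • wedge (g t a.succ) (g t b.succ)) i j) t

/-- The reduced Lagrangian `L(q, q̇)` on `T Sⁿ⁻¹`. -/
def reducedLagrangian {n : ℕ} (A q v : Fin n → ℝ) : ℝ :=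
  1 / (2 * detA A) * (((A * v) ⬝ᵥ v) * ((A * q) ⬝ᵥ q) - ((A * q) ⬝ᵥ v) ^ 2)

/-- The momentum `p = ∂L/∂q̇`. -/
def momentum {n : ℕ} (A q v : Fin n → ℝ) : Fin n → ℝ :=
  (1 / detA A) • ((q ⬝ᵥ (A * q)) • (A * v) - (v ⬝ᵥ (A * q)) • (A * q))

/-- Solutions `(q, p)` over `I` of the reduced LR system on
`T^* Sⁿ⁻¹ = {(q, q) = 1, (q, p) = 0} ⊂ ℝ²ⁿ`. -/
structure IsReducedSolution {n : ℕ} (A : Fin n → ℝ) (I : Set ℝ) (q p : ℝ → Fin n → ℝ) : Prop where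
  sphere : ∀ t ∈ I, q t ⬝ᵥ q t = 1
  cotangent : ∀ t ∈ I, q t ⬝ᵥ p t = 0
  q_eq : ∀ t ∈ I, HasDerivAt q
    ((detA A / (q t ⬝ᵥ (A * q t))) • (A⁻¹ * p t - (p t ⬝ᵥ (A⁻¹ * q t)) • q t)) t
  p_eq : ∀ t ∈ I, HasDerivAt p
    (-(detA A * (p t ⬝ᵥ (A⁻¹ * p t) - (p t ⬝ᵥ q t) * (q t ⬝ᵥ (A⁻¹ * p t))) /
      (q t ⬝ᵥ (A * q t))) • q t) t

/-- `(g, ω)` projects onto `(q, p)` under `D → T Sⁿ⁻¹ ≅ T^* Sⁿ⁻¹`: `e_1 = q`, and `p` is the momentum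
of the velocity `ė_1 = -ω e_1`. -/
def ProjectsTo {k : ℕ} (A : Fin (k + 1) → ℝ) (I : Set ℝ)
    (g ω : ℝ → Matrix (Fin (k + 1)) (Fin (k + 1)) ℝ) (q p : ℝ → Fin (k + 1) → ℝ) : Prop :=
  ∀ t ∈ I, g t 0 = q t ∧ momentum A (g t 0) (-(ω t *ᵥ g t 0)) = p t

/-- The confocal quadric `Q(α) = {x | ∑ x_i² / (α - A_i) = -1}`, for `α` different from all `A_i`. -/
def confocalQuadric {n : ℕ} (A : Fin n → ℝ) (α : ℝ) : Set (Fin n → ℝ) :=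
  {x | ∑ i, x i ^ 2 / (α - A i) = -1}

/-- Half the gradient at `x` of the function that defines `Q(α)`: a normal vector of `Q(α)` at `x`. -/
def quadricNormal {n : ℕ} (A : Fin n → ℝ) (α : ℝ) (x : Fin n → ℝ) : Fin n → ℝ :=
  fun i => x i / (α - A i)

/-- The unit tangent `dc/ds` of a regular curve `c`, `s` being a natural parameter. -/
def unitTangent {n : ℕ} (c : ℝ → Fin n → ℝ) (t : ℝ) : Fin n → ℝ :=
  (√(deriv c t ⬝ᵥ deriv c t))⁻¹ • deriv c t

/-- `c` is a regular curve on `Q(α)` that is a geodesic in its natural parameter: the derivative of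
the unit tangent is normal to `Q(α)`. -/
structure IsGeodesicOn {n : ℕ} (A : Fin n → ℝ) (α : ℝ) (I : Set ℝ) (c : ℝ → Fin n → ℝ) : Prop where
  mem : ∀ t ∈ I, c t ∈ confocalQuadric A α
  differentiable : ∀ t ∈ I, DifferentiableAt ℝ c t
  regular : ∀ t ∈ I, deriv c t ≠ 0
  normal : ∀ t ∈ I, ∃ κ : ℝ, HasDerivAt (unitTangent c) (κ • quadricNormal A α (c t)) t

/-- The curve `X = (q, A q)^{-1/2} A q` on `Q(0)` with unit normal `q`. -/
def geodesicCurve {n : ℕ} (A : Fin n → ℝ) (q : ℝ → Fin n → ℝ) (t : ℝ) : Fin n → ℝ :=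
  (√(q t ⬝ᵥ (A * q t)))⁻¹ • (A * q t)

/-- The vector `γ = dX/ds`. -/
def gam {n : ℕ} (A : Fin n → ℝ) (q : ℝ → Fin n → ℝ) : ℝ → Fin n → ℝ :=
  unitTangent (geodesicCurve A q)

/-- `Π_γ = Id - (γ, γ)⁻¹ γ ⊗ γ`. -/
def orthProj {n : ℕ} (v : Fin n → ℝ) : Matrix (Fin n) (Fin n) ℝ :=
  1 - (v ⬝ᵥ v)⁻¹ • vecMulVec v v

/-- Moser's matrix `𝓛 = Π_γ (A - x ⊗ x) Π_γ` of the line `{x + σ γ}`. -/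
def laxMatrix {n : ℕ} (A x v : Fin n → ℝ) : Matrix (Fin n) (Fin n) ℝ :=
  orthProj v * (diagonal A - vecMulVec x x) * orthProj v

/-- `𝓛` along the tangent lines of the curve `X`. -/
def laxCurve {n : ℕ} (A : Fin n → ℝ) (q : ℝ → Fin n → ℝ) (t : ℝ) : Matrix (Fin n) (Fin n) ℝ :=
  laxMatrix A (geodesicCurve A q t) (gam A q t)

/-- The line `{x + σ v}` touches `Q(α)` at the point with homogeneous coordinates `[y : w]`: the
point is on the projective line and on the projective closure `∑ y_i² / (α - A_i) + w² = 0` of `Q(α)`,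
and the tangent hyperplane there contains `[v : 0]` and `[x : 1]`, hence the line.
For `w = 1`: `y = x + σ v ∈ Q(α)` and `v` is tangent to `Q(α)` at `y` (the last condition
then follows from the others). For `w = 0` the touching point is at infinity. -/
def TouchesAt {n : ℕ} (A : Fin n → ℝ) (α : ℝ) (x v y : Fin n → ℝ) (w : ℝ) : Prop :=
  y ≠ 0 ∧ (∃ σ : ℝ, y = w • x + σ • v) ∧ ∑ i, y i ^ 2 / (α - A i) + w ^ 2 = 0 ∧
    quadricNormal A α y ⬝ᵥ v = 0 ∧ quadricNormal A α y ⬝ᵥ x + w = 0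

/-- The matrix with the rows `e_1 = q`, `e_2 = 𝔫_2`, …, `e_{n-1} = 𝔫_{n-1}`, `e_n = γ`, where
`n = m + 2` and `N : Fin m → ℝ → ℝⁿ` lists `𝔫_2, …, 𝔫_{n-1}`. -/
def frame {m : ℕ} (A : Fin (m + 2) → ℝ) (q : ℝ → Fin (m + 2) → ℝ)
    (N : Fin m → ℝ → Fin (m + 2) → ℝ) (t : ℝ) : Matrix (Fin (m + 2)) (Fin (m + 2)) ℝ :=
  Matrix.of (Fin.cons (q t) (Fin.snoc (α := fun _ => Fin (m + 2) → ℝ) (fun j => N j t) (gam A q t)))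

/-- `N` lists unit eigenvectors `𝔫_2, …, 𝔫_{n-1}` of `𝓛` with the eigenvalues `α_2, …, α_{n-1}`,
continuous in time and with the signs chosen so that `(q, 𝔫_2, …, 𝔫_{n-1}, γ)` is positively
oriented. -/
structure IsNormalFamily {m : ℕ} (A : Fin (m + 2) → ℝ) (I : Set ℝ) (q : ℝ → Fin (m + 2) → ℝ)
    (α : Fin m → ℝ) (N : Fin m → ℝ → Fin (m + 2) → ℝ) : Prop where
  continuousOn : ∀ j, ContinuousOn (N j) I
  unit : ∀ t ∈ I, ∀ j, N j t ⬝ᵥ N j t = 1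
  eigenvector : ∀ t ∈ I, ∀ j, laxCurve A q t *ᵥ N j t = α j • N j t
  oriented : ∀ t ∈ I, 0 < (frame A q N t).det

end Veselova

end

noncomputable section

namespace Veselova

/-! ### Curves and constants of motion -/

/-! Everything rests on one linear equation. With ω = q ∧ q̇, the reduced equations say that q and p
both satisfy ẋ = -ωx, written `x ᵥ* ω` for row vectors (`transported_q`, `transported_p`). Since ω
is skew, scalar products of such transported vectors are constant.

Geodesic: Ẋ is a positive multiple of p (`hasDerivAt_geodesicCurve`) and |p| is constant, so γ =
p/|p| is transported too. Hence γ̇ is a multiple of q, which is normal to Q(0) at X.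

LR system: the constraint forces ω = q ∧ q̇ (`omega_eq`). A multiplier term is an arbitrary skew
matrix that annihilates q (`skew_expansion`), and (𝓘ω)q = -p, so the dynamic equation reduces to the
transport of p. Thus every positively oriented orthonormal transported frame with first vector q is
a solution (`isLRSolution_of_transported`).

Eigenvectors: for transported f, g orthogonal to q and γ, the number (f, 𝓛g) is constant
(`dotProduct_laxCurve_mulVec_eq`). An orthonormal eigenbasis of 𝓛 at one time, transported along the
trajectory, therefore stays an eigenbasis with the same eigenvalues; 𝓛 vanishes on q and γ and is
positive on their complement. If the eigenvalues are distinct, continuous unit eigenvectors agree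
with the transported ones up to constant signs. Contact with Q(α) is the equation 𝓛y = αy rewritten:
(α - A)y is minus a homogeneous point of the line.

Finally, two transported frames with the same ω differ by the constant matrix of their scalar
products, which gives 𝔑-independent uniqueness up to a rotation fixing q. -/

theorem hasDerivAt_dotProduct {n : ℕ} {f g : ℝ → Fin n → ℝ} {f' g' : Fin n → ℝ} {t : ℝ}
    (hf : HasDerivAt f f' t) (hg : HasDerivAt g g' t) :
    HasDerivAt (fun s => f s ⬝ᵥ g s) (f' ⬝ᵥ g t + f t ⬝ᵥ g') t := by
  simp only [dotProduct, ← Finset.sum_add_distrib]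
  exact HasDerivAt.fun_sum fun i _ => (hasDerivAt_pi.1 hf i).mul (hasDerivAt_pi.1 hg i)

theorem dotProduct_self_nonneg {n : ℕ} (x : Fin n → ℝ) : 0 ≤ x ⬝ᵥ x :=
  Finset.sum_nonneg fun i _ => mul_self_nonneg (x i)

theorem hasDerivAt_const_mul {n : ℕ} (A : Fin n → ℝ) {f : ℝ → Fin n → ℝ} {f' : Fin n → ℝ} {t : ℝ}
    (hf : HasDerivAt f f' t) : HasDerivAt (fun s => A * f s) (A * f') t :=
  hasDerivAt_pi.2 fun i => (hasDerivAt_pi.1 hf i).const_mul (A i)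

theorem eq_of_hasDerivAt_zero {I : Set ℝ} (hI : IsOpen I) (hI' : I.OrdConnected) {f : ℝ → ℝ}
    (hf : ∀ t ∈ I, HasDerivAt f 0 t) {s t : ℝ} (hs : s ∈ I) (ht : t ∈ I) : f s = f t :=
  hI.is_const_of_deriv_eq_zero hI'.isPreconnected
    (fun x hx => (hf x hx).differentiableAt.differentiableWithinAt)
    (fun x hx => (hf x hx).deriv) hs ht

/-! ### The linear equation `ẋ = -ω x` with skew-symmetric `ω` -/

theorem vecMul_dotProduct_of_skew {n : ℕ} {ω : Matrix (Fin n) (Fin n) ℝ} (hω : ωᵀ = -ω)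
    (x y : Fin n → ℝ) : (x ᵥ* ω) ⬝ᵥ y = -(x ⬝ᵥ (y ᵥ* ω)) := by
  rw [← dotProduct_mulVec, ← vecMul_transpose, hω, vecMul_neg, dotProduct_neg]

/-- Skewness makes the two terms of the derivative cancel. This conservation law yields uniqueness,
orthonormality of transported frames and constancy of the rotation between two of them. -/
theorem dotProduct_eq_of_transported {n : ℕ} {I : Set ℝ} (hI : IsOpen I) (hI' : I.OrdConnected)
    {ω : ℝ → Matrix (Fin n) (Fin n) ℝ} (hω : ∀ t ∈ I, (ω t)ᵀ = -ω t) {f g : ℝ → Fin n → ℝ}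
    (hf : ∀ t ∈ I, HasDerivAt f (f t ᵥ* ω t) t) (hg : ∀ t ∈ I, HasDerivAt g (g t ᵥ* ω t) t)
    {s t : ℝ} (hs : s ∈ I) (ht : t ∈ I) : f s ⬝ᵥ g s = f t ⬝ᵥ g t :=
  eq_of_hasDerivAt_zero (f := fun s => f s ⬝ᵥ g s) hI hI' (fun u hu =>
    (hasDerivAt_dotProduct (hf u hu) (hg u hu)).congr_deriv <| by
      rw [vecMul_dotProduct_of_skew (hω u hu), neg_add_cancel]) hs ht

/-- The difference is transported as well, so its length is conserved and remains zero. -/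
theorem eq_of_transported {n : ℕ} {I : Set ℝ} (hI : IsOpen I) (hI' : I.OrdConnected)
    {ω : ℝ → Matrix (Fin n) (Fin n) ℝ} (hω : ∀ t ∈ I, (ω t)ᵀ = -ω t) {f g : ℝ → Fin n → ℝ}
    (hf : ∀ t ∈ I, HasDerivAt f (f t ᵥ* ω t) t) (hg : ∀ t ∈ I, HasDerivAt g (g t ᵥ* ω t) t)
    {s t : ℝ} (hs : s ∈ I) (ht : t ∈ I) (h : f s = g s) : f t = g t := by
  have hd : ∀ u ∈ I, HasDerivAt (fun u => f u - g u) ((f u - g u) ᵥ* ω u) u := fun u hu => by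
    rw [sub_vecMul]; exact (hf u hu).sub (hg u hu)
  have := dotProduct_eq_of_transported hI hI' hω hd hd ht hs
  simp only [h, sub_self, dotProduct_zero] at this
  exact sub_eq_zero.1 (dotProduct_self_eq_zero.1 this)

theorem norm_vecMul_le {n : ℕ} (x : Fin n → ℝ) (M : Matrix (Fin n) (Fin n) ℝ) :
    ‖x ᵥ* M‖ ≤ (∑ i, ∑ j, |M i j|) * ‖x‖ := by
  refine (pi_norm_le_iff_of_nonneg (by positivity)).2 fun j => ?_
  calc ‖(x ᵥ* M) j‖ ≤ ∑ i, |x i * M i j| :=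
        Finset.abs_sum_le_sum_abs (fun i => x i * M i j) Finset.univ
    _ ≤ ∑ i, (∑ j, |M i j|) * ‖x‖ := Finset.sum_le_sum fun i _ => by
        rw [abs_mul, mul_comm]
        exact mul_le_mul (Finset.single_le_sum (f := fun j => |M i j|)
          (fun _ _ => abs_nonneg _) (Finset.mem_univ j)) (norm_le_pi_norm x i) (abs_nonneg _)
          (by positivity)
    _ = _ := by rw [Finset.sum_mul]

/-- A radial retraction that fixes the sphere `x ⬝ᵥ x = r` and has bounded image. -/
def radialCutoff {n : ℕ} (r : ℝ) (x : Fin n → ℝ) : Fin n → ℝ := ((1 + r) / (1 + x ⬝ᵥ x)) • x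

theorem norm_radialCutoff_le {n : ℕ} {r : ℝ} (hr : 0 ≤ r) (x : Fin n → ℝ) :
    ‖radialCutoff r x‖ ≤ 1 + r := by
  refine (pi_norm_le_iff_of_nonneg (by positivity)).2 fun i => ?_
  have h0 : 0 ≤ x ⬝ᵥ x := dotProduct_self_nonneg x
  have h1 : x i * x i ≤ x ⬝ᵥ x :=
    Finset.single_le_sum (f := fun i => x i * x i) (fun i _ => mul_self_nonneg _) (Finset.mem_univ i)
  have h2 : |x i| ≤ 1 + x ⬝ᵥ x := by
    rcases abs_cases (x i) with h | h <;> nlinarith [sq_nonneg (x i - 1), sq_nonneg (x i + 1)]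
  rw [radialCutoff, Pi.smul_apply, smul_eq_mul, Real.norm_eq_abs, abs_mul,
    abs_of_nonneg (div_nonneg (by linarith) (by linarith)), div_mul_eq_mul_div,
    div_le_iff₀ (by linarith)]
  exact mul_le_mul_of_nonneg_left h2 (by linarith)

theorem contDiff_radialCutoff {n : ℕ} (r : ℝ) :
    ContDiff ℝ 1 (radialCutoff r : (Fin n → ℝ) → Fin n → ℝ) := by
  have h : ContDiff ℝ 1 fun x : Fin n → ℝ => x ⬝ᵥ x := by
    simp only [dotProduct]; fun_prop
  unfold radialCutoff
  refine ContDiff.smul (contDiff_const.div (contDiff_const.add h) fun x => ?_) contDiff_id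
  have : 0 ≤ x ⬝ᵥ x := dotProduct_self_nonneg x
  positivity

/-- Picard–Lindelöf needs a bound L of the field on a ball of radius at least L·T, which a linear
field need not satisfy on a long interval. The field composed with `radialCutoff` is bounded
globally, so the radius L·T is admissible. The cut-off vector is a multiple of x, so skewness still
conserves x ⬝ᵥ x; the solution stays on the sphere where the cutoff is the identity and hence solves
the original equation. -/
theorem exists_transported_Icc {n : ℕ} {a b t₀ : ℝ} (ht₀ : t₀ ∈ Set.Icc a b)
    {ω : ℝ → Matrix (Fin n) (Fin n) ℝ} (hω : ∀ t ∈ Set.Icc a b, (ω t)ᵀ = -ω t)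
    (hc : ∀ i j, ContinuousOn (fun t => ω t i j) (Set.Icc a b)) (x₀ : Fin n → ℝ) :
    ∃ f : ℝ → Fin n → ℝ, f t₀ = x₀ ∧ ∀ t ∈ Set.Ioo a b, HasDerivAt f (f t ᵥ* ω t) t := by
  set r := x₀ ⬝ᵥ x₀ with hrdef
  have hr : 0 ≤ r := dotProduct_self_nonneg x₀
  obtain ⟨B, hB⟩ := isCompact_Icc.exists_bound_of_continuousOn
    (f := fun t => ∑ i, ∑ j, |ω t i j|) (s := Set.Icc a b)
    (continuousOn_finsetSum _ fun i _ => continuousOn_finsetSum _ fun j _ => (hc i j).abs)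
  have hB' : ∀ t ∈ Set.Icc a b, ∀ x : Fin n → ℝ, ‖x ᵥ* ω t‖ ≤ B * ‖x‖ := fun t ht x =>
    (norm_vecMul_le x _).trans (mul_le_mul_of_nonneg_right ((le_abs_self _).trans (hB t ht))
      (norm_nonneg x))
  have hB0 : 0 ≤ B := (norm_nonneg _).trans (hB t₀ ht₀)
  set T := max (b - t₀) (t₀ - a)
  have hT : 0 ≤ T := le_max_of_le_left (sub_nonneg.2 ht₀.2)
  lift B to NNReal using hB0
  obtain ⟨L, hL⟩ : ∃ L : NNReal, (L : ℝ) = B * (1 + r) := ⟨⟨B * (1 + r), by positivity⟩, rfl⟩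
  obtain ⟨ρ, hρ⟩ : ∃ ρ : NNReal, (ρ : ℝ) = L * T := ⟨⟨L * T, by positivity⟩, rfl⟩
  obtain ⟨K, hK⟩ := (contDiff_radialCutoff (n := n) r).contDiffOn.exists_lipschitzOnWith
    (s := Metric.closedBall x₀ ρ) one_ne_zero (convex_closedBall _ _) (isCompact_closedBall _ _)
  have hPL : IsPicardLindelof (fun t x => radialCutoff r x ᵥ* ω t) (⟨t₀, ht₀⟩ : Set.Icc a b) x₀
      ρ 0 L (B * K) := by
    refine ⟨fun t ht => ?_, fun x _ => ?_, fun t ht x _ => ?_, by simp [hρ, T]⟩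
    · refine LipschitzOnWith.of_dist_le_mul fun x hx y hy => ?_
      rw [dist_eq_norm, ← sub_vecMul, NNReal.coe_mul, mul_assoc]
      refine (hB' t ht _).trans (mul_le_mul_of_nonneg_left ?_ B.2)
      rw [← dist_eq_norm]
      exact hK.dist_le_mul x hx y hy
    · refine continuousOn_pi.2 fun j => ?_
      simp only [vecMul, dotProduct]
      exact continuousOn_finsetSum _ fun i _ => continuousOn_const.mul (hc i j)
    · rw [hL]
      exact (hB' t ht _).trans (mul_le_mul_of_nonneg_left (norm_radialCutoff_le hr x) B.2)
  obtain ⟨f, hf₀, hf⟩ := hPL.exists_eq_forall_mem_Icc_hasDerivWithinAt₀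
  have hnorm : ∀ t ∈ Set.Icc a b, f t ⬝ᵥ f t = r := by
    have hd : ∀ t ∈ Set.Icc a b,
        HasDerivWithinAt (fun s => f s ⬝ᵥ f s) 0 (Set.Icc a b) t := fun t ht => by
      have h1 : HasDerivWithinAt (fun s => f s ⬝ᵥ f s)
          ((radialCutoff r (f t) ᵥ* ω t) ⬝ᵥ f t + f t ⬝ᵥ (radialCutoff r (f t) ᵥ* ω t))
          (Set.Icc a b) t := by
        simp only [dotProduct, ← Finset.sum_add_distrib]
        exact HasDerivWithinAt.fun_sum fun i _ =>
          (hasDerivWithinAt_pi.1 (hf t ht) i).mul (hasDerivWithinAt_pi.1 (hf t ht) i)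
      refine h1.congr_deriv ?_
      rw [radialCutoff, smul_vecMul, dotProduct_smul, smul_dotProduct,
        vecMul_dotProduct_of_skew (hω t ht), smul_neg, neg_add_cancel]
    have hcst := constant_of_has_deriv_right_zero
      (fun t ht => (hd t ht).continuousWithinAt)
      (fun t ht => (hd t ⟨ht.1, ht.2.le⟩).mono_of_mem_nhdsWithin (Icc_mem_nhdsGE_of_mem ht))
    intro t ht
    rw [hcst t ht, ← hcst t₀ ht₀]
    have : f t₀ = x₀ := hf₀
    rw [this]
  refine ⟨f, hf₀, fun t ht => ?_⟩
  have ht' := Set.Ioo_subset_Icc_self ht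
  refine ((hf t ht').hasDerivAt (Icc_mem_nhds ht.1 ht.2)).congr_deriv ?_
  rw [radialCutoff, hnorm t ht', div_self (by positivity), one_smul]

/-- Solutions on compact intervals around t₀ are glued; uniqueness makes them agree on overlaps, all
of which contain t₀. -/
theorem exists_transported {n : ℕ} {I : Set ℝ} (hI : IsOpen I) (hI' : I.OrdConnected)
    {t₀ : ℝ} (ht₀ : t₀ ∈ I)
    {ω : ℝ → Matrix (Fin n) (Fin n) ℝ} (hω : ∀ t ∈ I, (ω t)ᵀ = -ω t)
    (hc : ∀ i j, ContinuousOn (fun t => ω t i j) I) (x₀ : Fin n → ℝ) :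
    ∃ f : ℝ → Fin n → ℝ, f t₀ = x₀ ∧ ∀ t ∈ I, HasDerivAt f (f t ᵥ* ω t) t := by
  have hab : ∀ t ∈ I, ∃ a b, t ∈ Set.Ioo a b ∧ t₀ ∈ Set.Ioo a b ∧ Set.Icc a b ⊆ I := by
    have hnear : ∀ t ∈ I, ∃ a b, a < t ∧ t < b ∧ a ∈ I ∧ b ∈ I := fun t ht => by
      obtain ⟨ε, hε, h⟩ := Metric.isOpen_iff.1 hI t ht
      refine ⟨t - ε / 2, t + ε / 2, by linarith, by linarith, h ?_, h ?_⟩ <;>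
        simp [abs_of_pos hε, hε]
    intro t ht
    obtain ⟨a, b, h1, h2, h3, h4⟩ := hnear t ht
    obtain ⟨c, d, k1, k2, k3, k4⟩ := hnear t₀ ht₀
    refine ⟨min a c, max b d, ⟨by simp [h1], by simp [h2]⟩, ⟨by simp [k1], by simp [k2]⟩, ?_⟩
    refine hI'.out ?_ ?_
    · rcases min_choice a c with h | h <;> rw [h] <;> assumption
    · rcases max_choice b d with h | h <;> rw [h] <;> assumption
  have hloc : ∀ t : I, ∃ (a b : ℝ) (f : ℝ → Fin n → ℝ), (t : ℝ) ∈ Set.Ioo a b ∧ t₀ ∈ Set.Ioo a b ∧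
      Set.Icc a b ⊆ I ∧ f t₀ = x₀ ∧ ∀ s ∈ Set.Ioo a b, HasDerivAt f (f s ᵥ* ω s) s := fun t => by
    obtain ⟨a, b, h1, h2, h3⟩ := hab t t.2
    obtain ⟨f, hf⟩ := exists_transported_Icc (Set.Ioo_subset_Icc_self h2)
      (fun t ht => hω t (h3 ht)) (fun i j => (hc i j).mono h3) x₀
    exact ⟨a, b, f, h1, h2, h3, hf⟩
  choose a b f h1 h2 h3 h4 h5 using hloc
  classical
  have key : ∀ (t s : I), (s : ℝ) ∈ Set.Ioo (a t) (b t) → f s s = f t s := fun t s hs => by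
    refine eq_of_transported (I := Set.Ioo (a t) (b t) ∩ Set.Ioo (a s) (b s))
      (isOpen_Ioo.inter isOpen_Ioo) (Set.ordConnected_Ioo.inter Set.ordConnected_Ioo)
      (fun u hu => hω u (h3 t (Set.Ioo_subset_Icc_self hu.1)))
      (fun u hu => h5 s u hu.2) (fun u hu => h5 t u hu.1) ⟨h2 t, h2 s⟩ ⟨hs, h1 s⟩ ?_
    rw [h4, h4]
  -- The value at t is read off the solution on the interval chosen for t; the value 0 outside I is
  -- arbitrary.
  refine ⟨fun t => if h : t ∈ I then f ⟨t, h⟩ t else 0, by simp [ht₀, h4], fun t ht => ?_⟩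
  simp only [ht, dif_pos]
  refine (h5 ⟨t, ht⟩ t (h1 ⟨t, ht⟩)).congr_of_eventuallyEq ?_
  filter_upwards [Ioo_mem_nhds (h1 ⟨t, ht⟩).1 (h1 ⟨t, ht⟩).2] with s hs
  have hsI : s ∈ I := h3 ⟨t, ht⟩ (Set.Ioo_subset_Icc_self hs)
  simp only [hsI, dif_pos]
  exact key ⟨t, ht⟩ ⟨s, hsI⟩ hs

/-! ### Algebra of wedge products and diagonal matrices -/

theorem mul_dotProduct_comm {n : ℕ} (A x y : Fin n → ℝ) : (A * x) ⬝ᵥ y = x ⬝ᵥ (A * y) :=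
  Finset.sum_congr rfl fun i _ => by simp only [Pi.mul_apply]; ring

theorem inv_mul_mul_cancel {n : ℕ} {A : Fin n → ℝ} (hA : ∀ i, 0 < A i) (x : Fin n → ℝ) :
    A⁻¹ * (A * x) = x := by
  ext i
  simp [inv_mul_cancel_left₀ (hA i).ne']

theorem dotProduct_mul_self_pos {n : ℕ} {A : Fin n → ℝ} (hA : ∀ i, 0 < A i) {x : Fin n → ℝ}
    (hx : x ≠ 0) : 0 < x ⬝ᵥ (A * x) := by
  obtain ⟨i, hi⟩ := Function.ne_iff.1 hx
  have h : ∀ j, 0 ≤ x j * (A j * x j) := fun j => by nlinarith [mul_self_nonneg (x j), hA j]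
  refine Finset.sum_pos' (fun j _ => h j) ⟨i, Finset.mem_univ i, ?_⟩
  have : 0 < x i * x i := mul_self_pos.2 hi
  simp only [Pi.mul_apply]
  nlinarith [hA i]

theorem detA_pos {n : ℕ} {A : Fin n → ℝ} (hA : ∀ i, 0 < A i) : 0 < detA A :=
  Finset.prod_pos fun i _ => hA i

theorem ne_zero_of_dotProduct_self {n : ℕ} {x : Fin n → ℝ} (hx : x ⬝ᵥ x = 1) : x ≠ 0 := by
  rintro rfl
  simp at hx

theorem transpose_wedge {n : ℕ} (x y : Fin n → ℝ) : (wedge x y)ᵀ = -wedge x y := by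
  ext i j
  simp [wedge, vecMulVec_apply, mul_comm]

theorem vecMul_wedge {n : ℕ} (z x y : Fin n → ℝ) :
    z ᵥ* wedge x y = (z ⬝ᵥ x) • y - (z ⬝ᵥ y) • x := by
  simp [wedge, vecMul_sub, vecMul_vecMulVec]

theorem wedge_mulVec {n : ℕ} (x y z : Fin n → ℝ) :
    wedge x y *ᵥ z = (y ⬝ᵥ z) • x - (x ⬝ᵥ z) • y := by
  ext i
  simp [wedge, sub_mulVec, vecMulVec_mulVec]

theorem killing_wedge_of_skew {n : ℕ} {ω : Matrix (Fin n) (Fin n) ℝ} (hω : ωᵀ = -ω)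
    (x y : Fin n → ℝ) : killing ω (wedge x y) = x ⬝ᵥ (ω *ᵥ y) := by
  have h : y ⬝ᵥ (ω *ᵥ x) = -(x ⬝ᵥ (ω *ᵥ y)) := by
    rw [dotProduct_mulVec, vecMul_dotProduct_of_skew hω, dotProduct_comm, ← dotProduct_mulVec,
      dotProduct_comm]
  simp only [killing, wedge, mul_sub, trace_sub, mul_vecMulVec, trace_vecMulVec]
  rw [dotProduct_comm, h, dotProduct_comm]
  ring

/-! ### The reduced system -/

/-- The right-hand side of the equation for `q` in the reduced system. -/
def velocity {n : ℕ} (A q p : Fin n → ℝ) : Fin n → ℝ :=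
  (detA A / (q ⬝ᵥ (A * q))) • (A⁻¹ * p - (p ⬝ᵥ (A⁻¹ * q)) • q)

section pointwise

variable {n : ℕ} {A q p : Fin n → ℝ}

theorem dotProduct_velocity_left (hq : q ⬝ᵥ q = 1) : q ⬝ᵥ velocity A q p = 0 := by
  rw [velocity, dotProduct_smul, dotProduct_sub, dotProduct_smul, hq, ← mul_dotProduct_comm A⁻¹,
    dotProduct_comm p]
  simp

theorem dotProduct_velocity_right (hqp : q ⬝ᵥ p = 0) :
    p ⬝ᵥ velocity A q p = detA A / (q ⬝ᵥ (A * q)) * (p ⬝ᵥ (A⁻¹ * p)) := by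
  rw [velocity, dotProduct_smul, dotProduct_sub, dotProduct_smul, dotProduct_comm p q, hqp]
  simp

theorem velocity_dotProduct_mul (hA : ∀ i, 0 < A i) (hq : q ⬝ᵥ q = 1) (hqp : q ⬝ᵥ p = 0) :
    velocity A q p ⬝ᵥ (A * q) = -(detA A * (p ⬝ᵥ (A⁻¹ * q))) := by
  have hσ := dotProduct_mul_self_pos hA (ne_zero_of_dotProduct_self hq)
  rw [velocity, smul_dotProduct, sub_dotProduct, smul_dotProduct, mul_dotProduct_comm,
    inv_mul_mul_cancel hA, dotProduct_comm p q, hqp]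
  simp only [smul_eq_mul]
  field_simp
  ring

/-- The equation for q is the inverse Legendre transform: the multiples of Aq in the momentum
cancel. -/
theorem momentum_velocity (hA : ∀ i, 0 < A i) (hq : q ⬝ᵥ q = 1) (hqp : q ⬝ᵥ p = 0) :
    momentum A q (velocity A q p) = p := by
  have hσ := dotProduct_mul_self_pos hA (ne_zero_of_dotProduct_self hq)
  have hd := detA_pos hA
  rw [momentum, velocity_dotProduct_mul hA hq hqp]
  ext i
  have := (hA i).ne'
  simp only [velocity, Pi.smul_apply, Pi.sub_apply, Pi.mul_apply, Pi.inv_apply, smul_eq_mul]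
  field_simp
  ring

/-- Euler's identity for the Lagrangian, which is quadratic in v. -/
theorem momentum_dotProduct {v : Fin n → ℝ} :
    momentum A q v ⬝ᵥ v = 2 * reducedLagrangian A q v := by
  simp only [momentum, reducedLagrangian, smul_dotProduct, sub_dotProduct, smul_eq_mul,
    dotProduct_comm v (A * q), dotProduct_comm q (A * q)]
  by_cases h : detA A = 0
  · simp [h]
  · field_simp

end pointwise

namespace IsReducedSolution

variable {n : ℕ} {A : Fin n → ℝ} {I : Set ℝ} {q p : ℝ → Fin n → ℝ}

theorem hasDerivAt_q (h : IsReducedSolution A I q p) {t : ℝ} (ht : t ∈ I) :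
    HasDerivAt q (velocity A (q t) (p t)) t := h.q_eq t ht

theorem deriv_q (h : IsReducedSolution A I q p) {t : ℝ} (ht : t ∈ I) :
    deriv q t = velocity A (q t) (p t) := (h.q_eq t ht).deriv

theorem inner_pos (h : IsReducedSolution A I q p) (hA : ∀ i, 0 < A i) {t : ℝ} (ht : t ∈ I) :
    0 < q t ⬝ᵥ (A * q t) :=
  dotProduct_mul_self_pos hA (ne_zero_of_dotProduct_self (h.sphere t ht))

theorem momentum_deriv (h : IsReducedSolution A I q p) (hA : ∀ i, 0 < A i) {t : ℝ} (ht : t ∈ I) :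
    momentum A (q t) (deriv q t) = p t := by
  rw [h.deriv_q ht, momentum_velocity hA (h.sphere t ht) (h.cotangent t ht)]

theorem dotProduct_deriv (h : IsReducedSolution A I q p) {t : ℝ} (ht : t ∈ I) :
    q t ⬝ᵥ deriv q t = 0 := by
  rw [h.deriv_q ht, dotProduct_velocity_left (h.sphere t ht)]

theorem hasDerivAt_p (h : IsReducedSolution A I q p) {t : ℝ} (ht : t ∈ I) :
    HasDerivAt p (-(p t ⬝ᵥ deriv q t) • q t) t := by
  refine (h.p_eq t ht).congr_deriv ?_
  rw [h.deriv_q ht, dotProduct_velocity_right (h.cotangent t ht), dotProduct_comm (p t) (q t),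
    h.cotangent t ht]
  congr 1
  ring

theorem transported_q (h : IsReducedSolution A I q p) {t : ℝ} (ht : t ∈ I) :
    HasDerivAt q (q t ᵥ* wedge (q t) (deriv q t)) t := by
  refine (h.hasDerivAt_q ht).congr_deriv ?_
  rw [vecMul_wedge, h.sphere t ht, h.dotProduct_deriv ht, ← h.deriv_q ht]
  simp

/-- Because p is orthogonal to q, ωp = (p, q̇)q, and ṗ is exactly -(p, q̇)q. The momentum thus moves
like a vector of the frame. -/
theorem transported_p (h : IsReducedSolution A I q p) {t : ℝ} (ht : t ∈ I) :
    HasDerivAt p (p t ᵥ* wedge (q t) (deriv q t)) t := by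
  refine (h.hasDerivAt_p ht).congr_deriv ?_
  rw [vecMul_wedge, dotProduct_comm (p t) (q t), h.cotangent t ht]
  simp

/-- The dynamic equation contains q̈, while the hypotheses give only first derivatives; near t, q̇
is a smooth expression in the differentiable curves q and p. -/
theorem differentiableAt_deriv_q (h : IsReducedSolution A I q p) (hA : ∀ i, 0 < A i)
    (hI : IsOpen I) {t : ℝ} (ht : t ∈ I) : DifferentiableAt ℝ (deriv q) t := by
  have hq := h.hasDerivAt_q ht
  have hp := h.hasDerivAt_p ht
  have h1 : DifferentiableAt ℝ (fun s => velocity A (q s) (p s)) t := by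
    unfold velocity
    refine DifferentiableAt.fun_smul ?_ (DifferentiableAt.fun_sub ?_ (DifferentiableAt.fun_smul ?_ ?_))
    · exact (differentiableAt_const _).div
        (hasDerivAt_dotProduct hq (hasDerivAt_const_mul A hq)).differentiableAt
        (h.inner_pos hA ht).ne'
    · exact (hasDerivAt_const_mul _ hp).differentiableAt
    · exact (hasDerivAt_dotProduct hp (hasDerivAt_const_mul _ hq)).differentiableAt
    · exact hq.differentiableAt
  refine h1.congr_of_eventuallyEq ?_
  filter_upwards [hI.mem_nhds ht] with s hs using h.deriv_q hs

theorem hasDerivAt_inner (h : IsReducedSolution A I q p) (hA : ∀ i, 0 < A i) {t : ℝ}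
    (ht : t ∈ I) :
    HasDerivAt (fun s => q s ⬝ᵥ (A * q s)) (-(2 * detA A * (p t ⬝ᵥ (A⁻¹ * q t)))) t := by
  have hq := h.hasDerivAt_q ht
  refine (hasDerivAt_dotProduct hq (hasDerivAt_const_mul A hq)).congr_deriv ?_
  rw [← mul_dotProduct_comm A (q t), dotProduct_comm (A * q t),
    velocity_dotProduct_mul hA (h.sphere t ht) (h.cotangent t ht)]
  ring

theorem dotProduct_p_self_eq (h : IsReducedSolution A I q p) (hI : IsOpen I)
    (hI' : I.OrdConnected) {s t : ℝ} (hs : s ∈ I) (ht : t ∈ I) : p s ⬝ᵥ p s = p t ⬝ᵥ p t :=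
  dotProduct_eq_of_transported hI hI' (fun t _ => transpose_wedge (q t) (deriv q t))
    (fun _ => h.transported_p) (fun _ => h.transported_p) hs ht

/-! ### The geodesic -/

/-- In Aq̇ and in the derivative of (q, Aq)^(-1/2) the multiples of Aq are opposite, so only p
survives. -/
theorem hasDerivAt_geodesicCurve (h : IsReducedSolution A I q p) (hA : ∀ i, 0 < A i) {t : ℝ}
    (ht : t ∈ I) : HasDerivAt (geodesicCurve A q)
      ((detA A * (√(q t ⬝ᵥ (A * q t)))⁻¹ ^ 3) • p t) t := by
  have hq := h.hasDerivAt_q ht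
  have hσ := h.inner_pos hA ht
  have hs : 0 < √(q t ⬝ᵥ (A * q t)) := Real.sqrt_pos.2 hσ
  have hss : √(q t ⬝ᵥ (A * q t)) * √(q t ⬝ᵥ (A * q t)) = q t ⬝ᵥ (A * q t) :=
    Real.mul_self_sqrt hσ.le
  have h1 := (((h.hasDerivAt_inner hA ht).sqrt hσ.ne').fun_inv hs.ne').fun_smul
    (hasDerivAt_const_mul A hq)
  refine h1.congr_deriv ?_
  set r := √(q t ⬝ᵥ (A * q t)) with hr
  ext i
  have hAi := (hA i).ne'
  simp only [velocity, ← hss, Pi.add_apply, Pi.smul_apply, Pi.sub_apply, Pi.mul_apply,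
    Pi.inv_apply, smul_eq_mul]
  field_simp
  ring

/-- Normalization removes the positive factor in Ẋ. Where p = 0 both sides are 0. -/
theorem gam_eq (h : IsReducedSolution A I q p) (hA : ∀ i, 0 < A i) {t : ℝ} (ht : t ∈ I) :
    gam A q t = (√(p t ⬝ᵥ p t))⁻¹ • p t := by
  have hr : 0 < √(q t ⬝ᵥ (A * q t)) := Real.sqrt_pos.2 (h.inner_pos hA ht)
  have hc : 0 < detA A * (√(q t ⬝ᵥ (A * q t)))⁻¹ ^ 3 := mul_pos (detA_pos hA) (by positivity)
  rw [gam, unitTangent, (h.hasDerivAt_geodesicCurve hA ht).deriv]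
  set c := detA A * (√(q t ⬝ᵥ (A * q t)))⁻¹ ^ 3
  rw [smul_dotProduct, dotProduct_smul, smul_eq_mul, smul_eq_mul, ← mul_assoc,
    Real.sqrt_mul (by positivity), Real.sqrt_mul_self hc.le, smul_smul]
  congr 1
  rw [mul_inv, mul_right_comm, inv_mul_cancel₀ hc.ne', one_mul]

theorem dotProduct_p_self_pos (h : IsReducedSolution A I q p) (hI : IsOpen I)
    (hI' : I.OrdConnected) {t₀ : ℝ} (ht₀ : t₀ ∈ I) (hp : p t₀ ≠ 0) {t : ℝ} (ht : t ∈ I) :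
    0 < p t ⬝ᵥ p t := by
  rw [h.dotProduct_p_self_eq hI hI' ht ht₀]
  exact (dotProduct_self_nonneg _).lt_of_ne fun h0 => hp (dotProduct_self_eq_zero.1 h0.symm)

theorem transported_gam (h : IsReducedSolution A I q p) (hA : ∀ i, 0 < A i) (hI : IsOpen I)
    (hI' : I.OrdConnected) {t : ℝ} (ht : t ∈ I) :
    HasDerivAt (gam A q) (gam A q t ᵥ* wedge (q t) (deriv q t)) t := by
  rw [h.gam_eq hA ht, smul_vecMul]
  refine ((h.transported_p ht).const_smul _).congr_of_eventuallyEq ?_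
  filter_upwards [hI.mem_nhds ht] with s hs
  rw [h.gam_eq hA hs, h.dotProduct_p_self_eq hI hI' hs ht, Pi.smul_apply]

theorem dotProduct_gam (h : IsReducedSolution A I q p) (hA : ∀ i, 0 < A i) {t : ℝ} (ht : t ∈ I) :
    q t ⬝ᵥ gam A q t = 0 := by
  rw [h.gam_eq hA ht, dotProduct_smul, h.cotangent t ht, smul_zero]

theorem dotProduct_gam_self (h : IsReducedSolution A I q p) (hA : ∀ i, 0 < A i) {t : ℝ}
    (ht : t ∈ I) (hp : 0 < p t ⬝ᵥ p t) : gam A q t ⬝ᵥ gam A q t = 1 := by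
  have := Real.mul_self_sqrt hp.le
  have h0 := (Real.sqrt_pos.2 hp).ne'
  rw [h.gam_eq hA ht, dotProduct_smul, smul_dotProduct, smul_eq_mul, smul_eq_mul]
  nth_rw 3 [← this]
  field_simp

theorem mul_eq_smul_geodesicCurve (h : IsReducedSolution A I q p) (hA : ∀ i, 0 < A i) {t : ℝ}
    (ht : t ∈ I) : A * q t = √(q t ⬝ᵥ (A * q t)) • geodesicCurve A q t := by
  rw [geodesicCurve, smul_smul, mul_inv_cancel₀ (Real.sqrt_pos.2 (h.inner_pos hA ht)).ne', one_smul]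

theorem isGeodesicOn (h : IsReducedSolution A I q p) (hA : ∀ i, 0 < A i)
    (hI : IsOpen I) (hI' : I.OrdConnected) (hp : ∀ t ∈ I, 0 < p t ⬝ᵥ p t) :
    IsGeodesicOn A 0 I (geodesicCurve A q) where
  mem t ht := by
    have hσ := h.inner_pos hA ht
    have hX : ∀ i, geodesicCurve A q t i ^ 2 / (0 - A i) =
        -((q t ⬝ᵥ (A * q t))⁻¹ * (q t i * (A i * q t i))) := fun i => by
      have hAi := (hA i).ne'
      simp only [geodesicCurve, Pi.smul_apply, smul_eq_mul, Pi.mul_apply, mul_pow, inv_pow,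
        Real.sq_sqrt hσ.le, zero_sub]
      field_simp
    simp only [confocalQuadric, Set.mem_ofPred_eq, hX, Finset.sum_neg_distrib, ← Finset.mul_sum]
    have : ∑ i, q t i * (A i * q t i) = q t ⬝ᵥ (A * q t) := rfl
    rw [this, inv_mul_cancel₀ hσ.ne']
  differentiable t ht := (h.hasDerivAt_geodesicCurve hA ht).differentiableAt
  regular t ht := by
    have hr : 0 < √(q t ⬝ᵥ (A * q t)) := Real.sqrt_pos.2 (h.inner_pos hA ht)
    rw [(h.hasDerivAt_geodesicCurve hA ht).deriv]
    refine smul_ne_zero (mul_pos (detA_pos hA) (by positivity)).ne' fun h0 => ?_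
    have := hp t ht
    simp [h0] at this
  normal t ht := by
    have hr : 0 < √(q t ⬝ᵥ (A * q t)) := Real.sqrt_pos.2 (h.inner_pos hA ht)
    -- The normal `quadricNormal A 0 X` is -(q, Aq)^(-1/2) q, while γ̇ = -(γ, q̇)q; κ is the ratio.
    refine ⟨(gam A q t ⬝ᵥ deriv q t) * √(q t ⬝ᵥ (A * q t)),
      (h.transported_gam hA hI hI' ht).congr_deriv ?_⟩
    rw [vecMul_wedge, dotProduct_comm, h.dotProduct_gam hA ht]
    ext i
    have hAi := (hA i).ne'
    simp only [geodesicCurve, quadricNormal, Pi.smul_apply, smul_eq_mul, Pi.mul_apply,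
      Pi.sub_apply]
    field_simp
    ring

theorem reducedLagrangian_eq (h : IsReducedSolution A I q p) (hA : ∀ i, 0 < A i) {t : ℝ}
    (ht : t ∈ I) : reducedLagrangian A (q t) (deriv q t) =
      detA A * (p t ⬝ᵥ (A⁻¹ * p t)) / (2 * (q t ⬝ᵥ (A * q t))) := by
  have h1 := momentum_dotProduct (A := A) (q := q t) (v := deriv q t)
  rw [h.momentum_deriv hA ht] at h1
  rw [h.deriv_q ht, dotProduct_velocity_right (h.cotangent t ht)] at h1
  rw [h.deriv_q ht]
  have hσ := (h.inner_pos hA ht).ne'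
  field_simp at h1 ⊢
  linarith

/-- Both (p, A⁻¹p) and (q, Aq) satisfy ẏ = -2 det A (p, A⁻¹q)(q, Aq)⁻¹ y, so their quotient is
constant. -/
theorem reducedLagrangian_const (h : IsReducedSolution A I q p) (hA : ∀ i, 0 < A i)
    (hI : IsOpen I) (hI' : I.OrdConnected) {s t : ℝ} (hs : s ∈ I) (ht : t ∈ I) :
    reducedLagrangian A (q s) (deriv q s) = reducedLagrangian A (q t) (deriv q t) := by
  rw [h.reducedLagrangian_eq hA hs, h.reducedLagrangian_eq hA ht]
  refine eq_of_hasDerivAt_zero hI hI'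
    (f := fun s => detA A * (p s ⬝ᵥ (A⁻¹ * p s)) / (2 * (q s ⬝ᵥ (A * q s)))) (fun u hu => ?_) hs ht
  have hσ := (h.inner_pos hA hu).ne'
  have hp := h.hasDerivAt_p hu
  refine (((hasDerivAt_dotProduct hp (hasDerivAt_const_mul A⁻¹ hp)).const_mul (detA A)).fun_div
    ((h.hasDerivAt_inner hA hu).const_mul 2) (by positivity)).congr_deriv ?_
  rw [← mul_dotProduct_comm _ (p u), dotProduct_smul, smul_dotProduct, h.deriv_q hu,
    dotProduct_velocity_right (h.cotangent u hu), mul_dotProduct_comm A⁻¹ (p u),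
    dotProduct_comm (q u) (A⁻¹ * p u), mul_dotProduct_comm A⁻¹ (p u)]
  simp only [smul_eq_mul]
  field_simp
  ring

/-- Both sides square to (det A)² (p, p)/(q, Aq)³, by (X, A⁻²X) = 1/(q, Aq) and the expression of
the energy through p. -/
theorem speed_eq (h : IsReducedSolution A I q p) (hA : ∀ i, 0 < A i) {t : ℝ} (ht : t ∈ I)
    (hp : 0 < p t ⬝ᵥ p t) :
    √(deriv (geodesicCurve A q) t ⬝ᵥ deriv (geodesicCurve A q) t) =
      √((geodesicCurve A q t ⬝ᵥ (A⁻¹ ^ 2 * geodesicCurve A q t)) /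
        (gam A q t ⬝ᵥ (A⁻¹ * gam A q t))) *
      √(detA A * (2 * reducedLagrangian A (q t) (deriv q t) / ((A * q t) ⬝ᵥ q t))) := by
  have hσ := h.inner_pos hA ht
  have hd := detA_pos hA
  have hp0 : p t ≠ 0 := by rintro h0; simp [h0] at hp
  have hpA : 0 < p t ⬝ᵥ (A⁻¹ * p t) :=
    dotProduct_mul_self_pos (fun i => inv_pos.2 (hA i)) hp0
  have hX : geodesicCurve A q t ⬝ᵥ (A⁻¹ ^ 2 * geodesicCurve A q t) = (q t ⬝ᵥ (A * q t))⁻¹ := by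
    have : ∀ i, geodesicCurve A q t i * ((A⁻¹ ^ 2 * geodesicCurve A q t) i) =
        (q t ⬝ᵥ (A * q t))⁻¹ * (q t i * q t i) := fun i => by
      have hAi := (hA i).ne'
      have hr := (Real.sqrt_pos.2 hσ).ne'
      have hss := Real.mul_self_sqrt hσ.le
      rw [geodesicCurve]
      set r := √(q t ⬝ᵥ (A * q t))
      simp only [Pi.smul_apply, smul_eq_mul, Pi.mul_apply, Pi.pow_apply, Pi.inv_apply, ← hss]
      field_simp
    rw [dotProduct, Finset.sum_congr rfl fun i _ => this i, ← Finset.mul_sum]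
    have h1 : ∑ i, q t i * q t i = 1 := h.sphere t ht
    rw [h1, mul_one]
  have hγ : gam A q t ⬝ᵥ (A⁻¹ * gam A q t) = (p t ⬝ᵥ p t)⁻¹ * (p t ⬝ᵥ (A⁻¹ * p t)) := by
    rw [h.gam_eq hA ht, mul_smul_comm, dotProduct_smul, smul_dotProduct, smul_eq_mul, smul_eq_mul,
      ← mul_assoc, ← mul_inv, Real.mul_self_sqrt hp.le]
  rw [hX, hγ, h.reducedLagrangian_eq hA ht, mul_dotProduct_comm A (q t),
    (h.hasDerivAt_geodesicCurve hA ht).deriv, ← Real.sqrt_mul (by positivity)]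
  congr 1
  have hss := Real.sq_sqrt hσ.le
  have h6 : ((√(q t ⬝ᵥ (A * q t)))⁻¹ ^ 3) * ((√(q t ⬝ᵥ (A * q t)))⁻¹ ^ 3) =
      (q t ⬝ᵥ (A * q t))⁻¹ ^ 3 := by
    rw [← mul_pow, ← mul_inv, Real.mul_self_sqrt hσ.le]
  rw [dotProduct_smul, smul_dotProduct, smul_eq_mul, smul_eq_mul,
    show ∀ a b c : ℝ, a * b * (a * b * c) = a ^ 2 * (b * b) * c from fun a b c => by ring, h6]
  field_simp

end IsReducedSolution

/-! ### Orthonormal frames -/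

section orthonormal

variable {n : ℕ} {g : Matrix (Fin n) (Fin n) ℝ}

theorem mul_transpose_apply_eq_dotProduct (g : Matrix (Fin n) (Fin n) ℝ) (i j : Fin n) :
    (g * gᵀ) i j = g i ⬝ᵥ g j := rfl

theorem mul_mul_transpose_apply (g B : Matrix (Fin n) (Fin n) ℝ) (i j : Fin n) :
    (g * B * gᵀ) i j = g i ⬝ᵥ (B *ᵥ g j) := by
  rw [dotProduct_mulVec]
  rfl

theorem mul_transpose_of_mem_SO (hg : g ∈ specialOrthogonalGroup (Fin n) ℝ) : g * gᵀ = 1 :=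
  (mem_orthogonalGroup_iff (Fin n) ℝ).1 (mem_specialOrthogonalGroup_iff.1 hg).1

theorem mem_SO_iff : g ∈ specialOrthogonalGroup (Fin n) ℝ ↔ g * gᵀ = 1 ∧ g.det = 1 := by
  rw [mem_specialOrthogonalGroup_iff, mem_orthogonalGroup_iff]

theorem dotProduct_row_of_mul_transpose (hg : g * gᵀ = 1) (i j : Fin n) :
    g i ⬝ᵥ g j = if i = j then 1 else 0 := by
  rw [← mul_transpose_apply_eq_dotProduct, hg, one_apply]

theorem transpose_mul_of_mul_transpose (hg : g * gᵀ = 1) : gᵀ * g = 1 :=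
  mul_eq_one_comm.1 hg

theorem eq_of_dotProduct_row_eq (hg : g * gᵀ = 1) {x y : Fin n → ℝ}
    (h : ∀ i, g i ⬝ᵥ x = g i ⬝ᵥ y) : x = y := by
  have h' : g *ᵥ x = g *ᵥ y := funext h
  have := congrArg (gᵀ *ᵥ ·) h'
  simpa [mulVec_mulVec, transpose_mul_of_mul_transpose hg] using this

theorem eq_sum_dotProduct_row (hg : g * gᵀ = 1) (x : Fin n → ℝ) :
    x = ∑ i, (g i ⬝ᵥ x) • g i := by
  have h : x = gᵀ *ᵥ (g *ᵥ x) := by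
    rw [mulVec_mulVec, transpose_mul_of_mul_transpose hg, one_mulVec]
  nth_rw 1 [h]
  ext j
  rw [Finset.sum_apply]
  have : ∑ i, g i j * (g i ⬝ᵥ x) = ∑ i, (g i ⬝ᵥ x) * g i j :=
    Finset.sum_congr rfl fun i _ => mul_comm _ _
  exact this

end orthonormal

theorem sum_skew_mul {k : ℕ} (c m : Fin k → Fin k → ℝ) (hc : ∀ a b, c b a = -c a b) :
    ∑ a, ∑ b, c a b * m a b = ∑ a, ∑ b ∈ Finset.Ioi a, c a b * (m a b - m b a) := by
  have hdiag : ∀ a, c a a = 0 := fun a => by linarith [hc a a]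
  have h := Finset.sum_sum_Ioi_add_eq_sum_sum_off_diag fun a b => c b a * m b a
  have h1 : ∑ a, ∑ b, c a b * m a b = ∑ a, ∑ b ∈ {a}ᶜ, c a b * m a b :=
    Finset.sum_congr rfl fun a _ => (Finset.sum_subset (Finset.subset_univ _) fun b _ hb => by
      simp only [Finset.mem_compl, Finset.mem_singleton, not_not] at hb
      rw [hb, hdiag, zero_mul]).symm
  rw [h1, ← h]
  refine Finset.sum_congr rfl fun a _ => Finset.sum_congr rfl fun b _ => ?_
  rw [hc a b]
  ring

/-- A skew-symmetric matrix that annihilates the first vector of an orthonormal frame is a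
combination of the wedge products of the other ones. -/
theorem skew_expansion {k : ℕ} {g B : Matrix (Fin (k + 1)) (Fin (k + 1)) ℝ} (hg : g * gᵀ = 1)
    (hB : Bᵀ = -B) (h0 : B *ᵥ g 0 = 0) :
    B = ∑ a : Fin k, ∑ b ∈ Finset.Ioi a,
      (g a.succ ⬝ᵥ (B *ᵥ g b.succ)) • wedge (g a.succ) (g b.succ) := by
  set C := g * B * gᵀ with hC
  have hCskew : ∀ i j, C j i = -C i j := fun i j => by
    have : Cᵀ = -C := by
      rw [hC, transpose_mul, transpose_mul, transpose_transpose, hB]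
      simp [Matrix.mul_assoc]
    exact congrFun (congrFun this i) j
  have hC0 : ∀ i, C i 0 = 0 := fun i => by
    rw [hC, mul_mul_transpose_apply, h0, dotProduct_zero]
  have hC0' : ∀ i, C 0 i = 0 := fun i => by rw [hCskew i 0, hC0, neg_zero]
  have hBC : B = gᵀ * C * g := by
    have := transpose_mul_of_mul_transpose hg
    calc B = (gᵀ * g) * B * (gᵀ * g) := by rw [this, Matrix.one_mul, Matrix.mul_one]
      _ = _ := by rw [hC]; simp only [Matrix.mul_assoc]
  ext x y
  have h1 : B x y = ∑ j, ∑ i, C i j * (g i x * g j y) := by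
    conv_lhs => rw [hBC]
    simp only [mul_apply, transpose_apply, Finset.sum_mul]
    exact Finset.sum_congr rfl fun j _ => Finset.sum_congr rfl fun i _ => by ring
  rw [h1, Finset.sum_comm, Fin.sum_univ_succ]
  simp only [Fin.sum_univ_succ (n := k), hC0, hC0', zero_mul, Finset.sum_const_zero, zero_add]
  rw [sum_skew_mul (fun a b : Fin k => C a.succ b.succ) (fun a b => g a.succ x * g b.succ y)
    fun a b => hCskew _ _]
  simp only [Matrix.sum_apply, Matrix.smul_apply, smul_eq_mul, wedge, Matrix.sub_apply,
    vecMulVec_apply]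
  refine Finset.sum_congr rfl fun a _ => Finset.sum_congr rfl fun b _ => ?_
  rw [hC, mul_mul_transpose_apply]

/-! ### Solutions of the LR system over a reduced solution -/

theorem inertia_transpose_of_skew {n : ℕ} (A : Fin n → ℝ) {ω : Matrix (Fin n) (Fin n) ℝ}
    (hω : ωᵀ = -ω) : (inertia A ω)ᵀ = -inertia A ω := by
  ext i j
  have : ω j i = -ω i j := congrFun (congrFun hω i) j
  simp only [inertia, transpose_apply, of_apply, Matrix.neg_apply, this]
  ring

/-- 𝓘(q ∧ v) = Aq ∧ Av / det A. Applied to q, it turns the LR dynamics into an equation for p. -/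
theorem inertia_wedge_mulVec {n : ℕ} (A q v : Fin n → ℝ) :
    inertia A (wedge q v) *ᵥ q = -momentum A q v := by
  have h : inertia A (wedge q v) = (1 / detA A) • wedge (A * q) (A * v) := by
    ext i j
    simp only [inertia, wedge, of_apply, Matrix.smul_apply, Matrix.sub_apply, vecMulVec_apply,
      smul_eq_mul, Pi.mul_apply]
    ring
  rw [h, smul_mulVec, wedge_mulVec, momentum, ← smul_neg, neg_sub, mul_dotProduct_comm A v,
    dotProduct_comm (A * q)]

theorem hasDerivAt_matrix_mulVec {n : ℕ} {M : ℝ → Matrix (Fin n) (Fin n) ℝ}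
    {M' : Matrix (Fin n) (Fin n) ℝ} {f : ℝ → Fin n → ℝ} {f' : Fin n → ℝ} {t : ℝ}
    (hM : ∀ i j, HasDerivAt (fun s => M s i j) (M' i j) t) (hf : HasDerivAt f f' t) :
    HasDerivAt (fun s => M s *ᵥ f s) (M' *ᵥ f t + M t *ᵥ f') t :=
  hasDerivAt_pi.2 fun i => hasDerivAt_dotProduct (f := fun s => M s i)
    (hasDerivAt_pi.2 (hM i)) hf

namespace IsReducedSolution

variable {k : ℕ} {A : Fin (k + 1) → ℝ} {I : Set ℝ} {q p : ℝ → Fin (k + 1) → ℝ}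

/-- With M = 𝓘ω, multipliers exist once B = Ṁ - [M, ω] annihilates q. Differentiating Mq = -p and
using q̇ = -ωq gives Bq = -(ṗ + ωp), which vanishes because p is transported. -/
theorem isLRSolution_of_transported (h : IsReducedSolution A I q p) (hA : ∀ i, 0 < A i)
    (hI : IsOpen I) {g : ℝ → Matrix (Fin (k + 1)) (Fin (k + 1)) ℝ}
    (hg : ∀ t ∈ I, g t ∈ specialOrthogonalGroup (Fin (k + 1)) ℝ) (hg0 : ∀ t ∈ I, g t 0 = q t)
    (hgd : ∀ t ∈ I, ∀ i, HasDerivAt (fun u => g u i) (g t i ᵥ* wedge (q t) (deriv q t)) t) :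
    IsLRSolution A I g (fun t => wedge (q t) (deriv q t)) where
  mem_SO := hg
  kinematic t ht i j := hasDerivAt_pi.1 (hgd t ht i) j
  constraint t ht a b _ := by
    have hgo := dotProduct_row_of_mul_transpose (mul_transpose_of_mem_SO (hg t ht))
    rw [killing_wedge_of_skew (transpose_wedge _ _), wedge_mulVec, ← hg0 t ht, dotProduct_sub,
      dotProduct_smul, dotProduct_smul, hgo, hgo, if_neg (Fin.succ_ne_zero a),
      if_neg (Fin.succ_ne_zero b).symm]
    simp
  dynamic t ht := by
    have hq : HasDerivAt q (deriv q t) t := h.deriv_q ht ▸ h.hasDerivAt_q ht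
    have hqq := (h.differentiableAt_deriv_q hA hI ht).hasDerivAt
    set M : ℝ → Matrix (Fin (k + 1)) (Fin (k + 1)) ℝ := fun u => inertia A (wedge (q u) (deriv q u))
    set M' := inertia A (wedge (q t) (deriv (deriv q) t)) with hM'
    set ω := wedge (q t) (deriv q t) with hω
    have hM : ∀ i j, HasDerivAt (fun u => M u i j) (M' i j) t := fun i j => by
      simp only [M, M', inertia, of_apply, wedge, Matrix.sub_apply, vecMulVec_apply]
      refine ((((hasDerivAt_pi.1 hq i).mul (hasDerivAt_pi.1 hqq j)).fun_sub
        ((hasDerivAt_pi.1 hqq i).mul (hasDerivAt_pi.1 hq j))).const_mul _).congr_deriv ?_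
      ring
    have hMskew : (M t)ᵀ = -M t := inertia_transpose_of_skew A (transpose_wedge _ _)
    have hωskew : ωᵀ = -ω := transpose_wedge _ _
    have hMq : M t *ᵥ q t = -p t := by
      rw [inertia_wedge_mulVec, h.momentum_deriv hA ht]
    set B := M' - (M t * ω - ω * M t) with hB
    have hBskew : Bᵀ = -B := by
      rw [hB, transpose_sub, transpose_sub, transpose_mul, transpose_mul, hMskew, hωskew, hM',
        inertia_transpose_of_skew A (transpose_wedge _ _)]
      simp only [Matrix.neg_mul, Matrix.mul_neg, neg_neg]
      abel
    have hB0 : B *ᵥ g t 0 = 0 := by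
      have h1 := hasDerivAt_matrix_mulVec hM hq
      have h2 : HasDerivAt (fun s => M s *ᵥ q s) (-(-(p t ⬝ᵥ deriv q t) • q t)) t := by
        refine (h.hasDerivAt_p ht).fun_neg.congr_of_eventuallyEq ?_
        filter_upwards [hI.mem_nhds ht] with s hs
        rw [inertia_wedge_mulVec, h.momentum_deriv hA hs]
      have h3 := h1.unique h2
      rw [hg0 t ht, hB, sub_mulVec, sub_mulVec, ← mulVec_mulVec, ← mulVec_mulVec, hMq,
        eq_sub_of_add_eq h3, hω, wedge_mulVec, mulVec_neg, wedge_mulVec, h.sphere t ht,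
        h.cotangent t ht, dotProduct_comm (deriv q t) (q t), h.dotProduct_deriv ht,
        dotProduct_comm (deriv q t) (p t)]
      simp only [mulVec_neg, zero_smul, zero_sub, one_smul, neg_smul, sub_zero, neg_neg]
      abel
    -- The multipliers are the matrix elements of B in the frame.
    refine ⟨fun a b => g t a.succ ⬝ᵥ (B *ᵥ g t b.succ), fun i j => (hM i j).congr_deriv ?_⟩
    rw [← skew_expansion (mul_transpose_of_mem_SO (hg t ht)) hBskew hB0, hB, add_sub_cancel]

end IsReducedSolution

namespace IsLRSolution

variable {k : ℕ} {A : Fin (k + 1) → ℝ} {I : Set ℝ}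
  {g ω : ℝ → Matrix (Fin (k + 1)) (Fin (k + 1)) ℝ}

theorem hasDerivAt_row (h : IsLRSolution A I g ω) {t : ℝ} (ht : t ∈ I) (i : Fin (k + 1)) :
    HasDerivAt (fun u => g u i) (g t i ᵥ* ω t) t :=
  hasDerivAt_pi.2 fun j => h.kinematic t ht i j

theorem mul_transpose (h : IsLRSolution A I g ω) {t : ℝ} (ht : t ∈ I) : g t * (g t)ᵀ = 1 :=
  mul_transpose_of_mem_SO (h.mem_SO t ht)

theorem skew (h : IsLRSolution A I g ω) (hI : IsOpen I) {t : ℝ} (ht : t ∈ I) :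
    (ω t)ᵀ = -ω t := by
  have hz : ∀ i j, (g t i ᵥ* ω t) ⬝ᵥ g t j + g t i ⬝ᵥ (g t j ᵥ* ω t) = 0 := fun i j => by
    refine (hasDerivAt_dotProduct (h.hasDerivAt_row ht i) (h.hasDerivAt_row ht j)).unique ?_
    refine (hasDerivAt_const t (if i = j then (1 : ℝ) else 0)).congr_of_eventuallyEq ?_
    filter_upwards [hI.mem_nhds ht] with s hs
    exact dotProduct_row_of_mul_transpose (h.mul_transpose hs) i j
  have hz' : g t * (ω t + (ω t)ᵀ) * (g t)ᵀ = 0 := by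
    ext i j
    rw [mul_mul_transpose_apply, add_mulVec, dotProduct_add, mulVec_transpose, dotProduct_mulVec]
    exact hz i j
  have hgg := transpose_mul_of_mul_transpose (h.mul_transpose ht)
  have : ω t + (ω t)ᵀ = 0 := by
    calc ω t + (ω t)ᵀ = ((g t)ᵀ * g t) * (ω t + (ω t)ᵀ) * ((g t)ᵀ * g t) := by
          rw [hgg, Matrix.one_mul, Matrix.mul_one]
      _ = (g t)ᵀ * (g t * (ω t + (ω t)ᵀ) * (g t)ᵀ) * g t := by simp only [Matrix.mul_assoc]
      _ = 0 := by rw [hz', Matrix.mul_zero, Matrix.zero_mul]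
  exact eq_neg_of_add_eq_zero_right this

/-- The difference of the two sides is skew and annihilates e_1; by the constraint its matrix
elements between the other frame vectors vanish too, so `skew_expansion` makes it zero. -/
theorem omega_eq (h : IsLRSolution A I g ω) (hI : IsOpen I) {t : ℝ} (ht : t ∈ I) :
    ω t = wedge (g t 0) (g t 0 ᵥ* ω t) := by
  have hω := h.skew hI ht
  have hgo := dotProduct_row_of_mul_transpose (h.mul_transpose ht)
  have h00 : g t 0 ⬝ᵥ (g t 0 ᵥ* ω t) = 0 := by
    have := vecMul_dotProduct_of_skew hω (g t 0) (g t 0)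
    rw [dotProduct_comm] at this
    linarith
  have hωq : ω t *ᵥ g t 0 = -(g t 0 ᵥ* ω t) := by
    rw [← vecMul_transpose, hω, vecMul_neg]
  rw [← sub_eq_zero]
  refine (skew_expansion (h.mul_transpose ht) (B := ω t - wedge (g t 0) (g t 0 ᵥ* ω t))
    ?_ ?_).trans ?_
  · rw [transpose_sub, hω, transpose_wedge]
    abel
  · rw [sub_mulVec, wedge_mulVec, hωq, dotProduct_comm _ (g t 0), h00, hgo]
    simp
  · refine Finset.sum_eq_zero fun a _ => Finset.sum_eq_zero fun b hb => ?_
    have := h.constraint t ht a b (Finset.mem_Ioi.1 hb)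
    rw [killing_wedge_of_skew hω] at this
    rw [sub_mulVec, dotProduct_sub, this, wedge_mulVec, dotProduct_sub, dotProduct_smul,
      dotProduct_smul, hgo, hgo, if_neg (Fin.succ_ne_zero a), if_neg (Fin.succ_ne_zero b).symm]
    simp

theorem omega_eq_wedge_deriv (h : IsLRSolution A I g ω) (hI : IsOpen I)
    {q : ℝ → Fin (k + 1) → ℝ} (hq : ∀ t ∈ I, g t 0 = q t) {t : ℝ} (ht : t ∈ I) :
    ω t = wedge (q t) (deriv q t) := by
  have hd : HasDerivAt q (g t 0 ᵥ* ω t) t := by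
    refine (h.hasDerivAt_row ht 0).congr_of_eventuallyEq ?_
    filter_upwards [hI.mem_nhds ht] with s hs using (hq s hs).symm
  rw [hd.deriv, ← hq t ht]
  exact h.omega_eq hI ht

end IsLRSolution

/-! ### Moser's matrix of a line -/

section lax

variable {n : ℕ} {A x v : Fin n → ℝ}

theorem orthProj_mulVec (hv : v ⬝ᵥ v = 1) (y : Fin n → ℝ) :
    orthProj v *ᵥ y = y - (v ⬝ᵥ y) • v := by
  ext i
  simp [orthProj, sub_mulVec, hv, vecMulVec_mulVec]

theorem transpose_orthProj (v : Fin n → ℝ) : (orthProj v)ᵀ = orthProj v := by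
  simp [orthProj, transpose_sub, transpose_smul, transpose_vecMulVec]

theorem transpose_laxMatrix (A x v : Fin n → ℝ) : (laxMatrix A x v)ᵀ = laxMatrix A x v := by
  simp [laxMatrix, transpose_mul, transpose_orthProj, transpose_sub, transpose_vecMulVec,
    Matrix.mul_assoc]

theorem laxMatrix_symm (A x v y z : Fin n → ℝ) :
    y ⬝ᵥ (laxMatrix A x v *ᵥ z) = (laxMatrix A x v *ᵥ y) ⬝ᵥ z := by
  rw [dotProduct_mulVec, ← mulVec_transpose, transpose_laxMatrix]

theorem laxMatrix_mulVec (hv : v ⬝ᵥ v = 1) {y : Fin n → ℝ} (hy : v ⬝ᵥ y = 0) :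
    laxMatrix A x v *ᵥ y =
      (A * y - (x ⬝ᵥ y) • x) - (v ⬝ᵥ (A * y - (x ⬝ᵥ y) • x)) • v := by
  have hd : diagonal A *ᵥ y = A * y := funext fun i => mulVec_diagonal _ _ _
  have hx : vecMulVec x x *ᵥ y = (x ⬝ᵥ y) • x := by
    ext i
    simp [vecMulVec_mulVec, mul_comm]
  rw [laxMatrix, ← mulVec_mulVec, ← mulVec_mulVec, orthProj_mulVec hv y, hy, zero_smul, sub_zero,
    sub_mulVec, hd, hx, orthProj_mulVec hv]

theorem laxMatrix_mulVec_self (hv : v ⬝ᵥ v = 1) : laxMatrix A x v *ᵥ v = 0 := by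
  rw [laxMatrix, ← mulVec_mulVec, orthProj_mulVec hv v, hv, one_smul, sub_self, mulVec_zero]

theorem dotProduct_laxMatrix_mulVec (hv : v ⬝ᵥ v = 1) {y z : Fin n → ℝ} (hy : v ⬝ᵥ y = 0)
    (hz : v ⬝ᵥ z = 0) :
    y ⬝ᵥ (laxMatrix A x v *ᵥ z) = y ⬝ᵥ (A * z) - (x ⬝ᵥ y) * (x ⬝ᵥ z) := by
  rw [laxMatrix_mulVec hv hz, dotProduct_sub, dotProduct_sub, dotProduct_smul, dotProduct_smul,
    dotProduct_comm y v, hy, dotProduct_comm y x]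
  simp [mul_comm]

/-- An eigenvector of Moser's matrix is normal to the confocal quadric of its eigenvalue at a
point where the line touches the quadric. -/
theorem exists_touchesAt_of_eigenvector {α : ℝ} (hα : ∀ i, α ≠ A i) (hv : v ⬝ᵥ v = 1)
    {y : Fin n → ℝ} (hy : y ≠ 0) (hvy : v ⬝ᵥ y = 0) (h : laxMatrix A x v *ᵥ y = α • y) :
    ∃ z w, TouchesAt A α x v z w := by
  rw [laxMatrix_mulVec hv hvy] at h
  -- The eigenvalue equation reads (A - α)y = (x, y)x + μv. Its right-hand side z is a homogeneous
  -- point of the line with weight w = (x, y), and the normal of Q(α) at z is -y. The contact is at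
  -- infinity when (x, y) = 0.
  set μ := v ⬝ᵥ (A * y - (x ⬝ᵥ y) • x) with hμ
  set z := (x ⬝ᵥ y) • x + μ • v with hz
  have hzi : ∀ i, z i = -(y i * (α - A i)) := fun i => by
    have := congrFun h i
    simp only [Pi.sub_apply, Pi.mul_apply, Pi.smul_apply, smul_eq_mul] at this
    simp only [hz, Pi.add_apply, Pi.smul_apply, smul_eq_mul]
    linarith
  have hN : quadricNormal A α z = -y := by
    ext i
    have : α - A i ≠ 0 := sub_ne_zero.2 (hα i)
    simp only [quadricNormal, hzi, Pi.neg_apply]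
    field_simp
  refine ⟨z, x ⬝ᵥ y, ?_, ⟨μ, rfl⟩, ?_, ?_, ?_⟩
  · intro h0
    apply hy
    rw [← neg_eq_zero, ← hN, h0]
    ext i
    simp [quadricNormal]
  · have h1 : ∑ i, z i ^ 2 / (α - A i) = quadricNormal A α z ⬝ᵥ z :=
      Finset.sum_congr rfl fun i _ => by simp only [quadricNormal]; ring
    rw [h1, hN, hz, neg_dotProduct, dotProduct_add, dotProduct_smul, dotProduct_smul,
      dotProduct_comm y v, hvy, dotProduct_comm y x]
    simp only [smul_eq_mul]
    ring
  · rw [hN, neg_dotProduct, dotProduct_comm, hvy, neg_zero]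
  · rw [hN, neg_dotProduct, dotProduct_comm, neg_add_cancel]

/-- The normal of a confocal quadric at a point of contact is an eigenvector of Moser's matrix. -/
theorem laxMatrix_mulVec_quadricNormal {α w : ℝ} (hα : ∀ i, α ≠ A i) (hv : v ⬝ᵥ v = 1)
    {z : Fin n → ℝ} (h : TouchesAt A α x v z w) :
    laxMatrix A x v *ᵥ quadricNormal A α z = α • quadricNormal A α z := by
  obtain ⟨-, ⟨σ, hσ⟩, -, hNv, hNx⟩ := h
  have hw : x ⬝ᵥ quadricNormal A α z = -w := by rw [dotProduct_comm]; linarith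
  have hvN : v ⬝ᵥ quadricNormal A α z = 0 := by rw [dotProduct_comm, hNv]
  have hAN : A * quadricNormal A α z - (-w) • x = α • quadricNormal A α z - σ • v := by
    ext i
    have : α - A i ≠ 0 := sub_ne_zero.2 (hα i)
    have h1 : z i = w * x i + σ * v i := by rw [hσ]; rfl
    have h2 : (α - A i) * quadricNormal A α z i = z i := by
      rw [quadricNormal]; field_simp
    simp only [Pi.sub_apply, Pi.mul_apply, Pi.smul_apply, smul_eq_mul]
    linarith
  rw [laxMatrix_mulVec hv hvN, hw, hAN, dotProduct_sub, dotProduct_smul, dotProduct_smul, hvN, hv]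
  simp

theorem TouchesAt.quadricNormal_ne_zero {α w : ℝ} (hα : ∀ i, α ≠ A i) {z : Fin n → ℝ}
    (h : TouchesAt A α x v z w) : quadricNormal A α z ≠ 0 := fun h0 => h.1 <| by
  ext i
  have h1 : z i / (α - A i) = 0 := congrFun h0 i
  simpa [sub_ne_zero.2 (hα i)] using h1

end lax

namespace IsReducedSolution

variable {n : ℕ} {A : Fin n → ℝ} {I : Set ℝ} {q p : ℝ → Fin n → ℝ}

/-- X is a multiple of Aq with (X, q)X = Aq, so A - X ⊗ X already annihilates q. -/
theorem laxCurve_mulVec_q (h : IsReducedSolution A I q p) (hA : ∀ i, 0 < A i) {t : ℝ}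
    (ht : t ∈ I) (hp : 0 < p t ⬝ᵥ p t) : laxCurve A q t *ᵥ q t = 0 := by
  have hσ := h.inner_pos hA ht
  have hγq : gam A q t ⬝ᵥ q t = 0 := by rw [dotProduct_comm, h.dotProduct_gam hA ht]
  have h0 : A * q t - (geodesicCurve A q t ⬝ᵥ q t) • geodesicCurve A q t = 0 := by
    rw [geodesicCurve, smul_dotProduct, smul_smul, smul_eq_mul, mul_dotProduct_comm, mul_right_comm,
      ← mul_inv, Real.mul_self_sqrt hσ.le, inv_mul_cancel₀ hσ.ne', one_smul, sub_self]
  rw [laxCurve, laxMatrix_mulVec (h.dotProduct_gam_self hA ht hp) hγq, h0]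
  simp

theorem laxCurve_mulVec_gam (h : IsReducedSolution A I q p) (hA : ∀ i, 0 < A i) {t : ℝ}
    (ht : t ∈ I) (hp : 0 < p t ⬝ᵥ p t) : laxCurve A q t *ᵥ gam A q t = 0 :=
  laxMatrix_mulVec_self (h.dotProduct_gam_self hA ht hp)

/-- `𝓛` is positive definite on the orthogonal complement of `q` and `γ`. -/
theorem dotProduct_laxCurve_pos (h : IsReducedSolution A I q p) (hA : ∀ i, 0 < A i) {t : ℝ}
    (ht : t ∈ I) (hp : 0 < p t ⬝ᵥ p t) {f : Fin n → ℝ} (hf : f ≠ 0) (hfq : q t ⬝ᵥ f = 0)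
    (hfγ : gam A q t ⬝ᵥ f = 0) : 0 < f ⬝ᵥ (laxCurve A q t *ᵥ f) := by
  have hσ := h.inner_pos hA ht
  set σ := q t ⬝ᵥ (A * q t) with hσdef
  set c := q t ⬝ᵥ (A * f)
  have hX : geodesicCurve A q t ⬝ᵥ f * (geodesicCurve A q t ⬝ᵥ f) = c ^ 2 / σ := by
    have : geodesicCurve A q t ⬝ᵥ f = (√σ)⁻¹ * c := by
      rw [geodesicCurve, smul_dotProduct, mul_dotProduct_comm, smul_eq_mul]
    rw [this, mul_mul_mul_comm, ← mul_inv, Real.mul_self_sqrt hσ.le]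
    field_simp
  -- Strict Cauchy–Schwarz for the form of A: f - (c/σ)q is the A-orthogonal projection of f off q,
  -- and its A-square is (f, 𝓛f).
  have hne : f - (c / σ) • q t ≠ 0 := fun h0 => hf <| by
    have h1 : f ⬝ᵥ (f - (c / σ) • q t) = 0 := by rw [h0, dotProduct_zero]
    rw [dotProduct_sub, dotProduct_smul, dotProduct_comm f (q t), hfq, smul_zero, sub_zero] at h1
    exact dotProduct_self_eq_zero.1 h1
  have hpos := dotProduct_mul_self_pos hA hne
  have h2 : (f - (c / σ) • q t) ⬝ᵥ (A * (f - (c / σ) • q t)) = f ⬝ᵥ (A * f) - c ^ 2 / σ := by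
    rw [mul_sub, mul_smul_comm, dotProduct_sub, sub_dotProduct, sub_dotProduct, dotProduct_smul,
      dotProduct_smul, smul_dotProduct, smul_dotProduct, ← mul_dotProduct_comm A f (q t),
      dotProduct_comm (A * f) (q t), ← hσdef]
    simp only [smul_eq_mul]
    field_simp
    ring
  rw [laxCurve, dotProduct_laxMatrix_mulVec (h.dotProduct_gam_self hA ht hp) hfγ hfγ, hX]
  linarith

/-- Matrix elements of `𝓛` between transported vectors are constants of motion. -/
theorem dotProduct_laxCurve_mulVec_eq (h : IsReducedSolution A I q p) (hA : ∀ i, 0 < A i)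
    (hI : IsOpen I) (hI' : I.OrdConnected) (hp : ∀ t ∈ I, 0 < p t ⬝ᵥ p t) {f g : ℝ → Fin n → ℝ}
    (hf : ∀ t ∈ I, HasDerivAt f (f t ᵥ* wedge (q t) (deriv q t)) t)
    (hg : ∀ t ∈ I, HasDerivAt g (g t ᵥ* wedge (q t) (deriv q t)) t)
    (hfq : ∀ t ∈ I, q t ⬝ᵥ f t = 0) (hgq : ∀ t ∈ I, q t ⬝ᵥ g t = 0)
    (hfγ : ∀ t ∈ I, gam A q t ⬝ᵥ f t = 0) (hgγ : ∀ t ∈ I, gam A q t ⬝ᵥ g t = 0)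
    {s t : ℝ} (hs : s ∈ I) (ht : t ∈ I) :
    f s ⬝ᵥ (laxCurve A q s *ᵥ g s) = f t ⬝ᵥ (laxCurve A q t *ᵥ g t) := by
  have hL : ∀ u ∈ I, f u ⬝ᵥ (laxCurve A q u *ᵥ g u) =
      f u ⬝ᵥ (A * g u) - (geodesicCurve A q u ⬝ᵥ f u) * (geodesicCurve A q u ⬝ᵥ g u) :=
    fun u hu => dotProduct_laxMatrix_mulVec (h.dotProduct_gam_self hA hu (hp u hu)) (hfγ u hu)
      (hgγ u hu)
  -- Such a vector moves only in the direction of q. The motion of X does not contribute to the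
  -- derivative of (X, e), since Ẋ is parallel to p, hence orthogonal to e.
  have hX : ∀ e : ℝ → Fin n → ℝ, (∀ t ∈ I, HasDerivAt e (e t ᵥ* wedge (q t) (deriv q t)) t) →
      (∀ t ∈ I, q t ⬝ᵥ e t = 0) → (∀ t ∈ I, gam A q t ⬝ᵥ e t = 0) → ∀ u ∈ I,
      HasDerivAt e (-(e u ⬝ᵥ deriv q u) • q u) u ∧
      HasDerivAt (fun u => geodesicCurve A q u ⬝ᵥ e u)
        (-(e u ⬝ᵥ deriv q u) * √(q u ⬝ᵥ (A * q u))) u := by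
    intro e he heq heγ u hu
    have hσ := h.inner_pos hA hu
    have h1 : HasDerivAt e (-(e u ⬝ᵥ deriv q u) • q u) u := by
      refine (he u hu).congr_deriv ?_
      rw [vecMul_wedge, dotProduct_comm (e u) (q u), heq u hu]
      simp
    refine ⟨h1, (hasDerivAt_dotProduct (h.hasDerivAt_geodesicCurve hA hu) h1).congr_deriv ?_⟩
    have hpe : p u ⬝ᵥ e u = 0 := by
      have := heγ u hu
      rw [h.gam_eq hA hu, smul_dotProduct, smul_eq_mul] at this
      exact (mul_eq_zero.1 this).resolve_left (inv_pos.2 (Real.sqrt_pos.2 (hp u hu))).ne'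
    have hXq : geodesicCurve A q u ⬝ᵥ q u = √(q u ⬝ᵥ (A * q u)) := by
      rw [geodesicCurve, smul_dotProduct, mul_dotProduct_comm, smul_eq_mul]
      nth_rw 2 [← Real.mul_self_sqrt hσ.le]
      exact inv_mul_cancel_left₀ (Real.sqrt_pos.2 hσ).ne' _
    rw [smul_dotProduct, hpe, dotProduct_smul, hXq]
    simp
  rw [hL s hs, hL t ht]
  refine eq_of_hasDerivAt_zero hI hI' (f := fun u => f u ⬝ᵥ (A * g u) -
    (geodesicCurve A q u ⬝ᵥ f u) * (geodesicCurve A q u ⬝ᵥ g u)) (fun u hu => ?_) hs ht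
  obtain ⟨f1, f2⟩ := hX f hf hfq hfγ u hu
  obtain ⟨g1, g2⟩ := hX g hg hgq hgγ u hu
  refine ((hasDerivAt_dotProduct f1 (hasDerivAt_const_mul A g1)).fun_sub
    (f2.fun_mul g2)).congr_deriv ?_
  -- Aq = (q, Aq)^(1/2) X is what makes the derivatives of (f, Ag) and (X, f)(X, g) cancel.
  have hXe : ∀ e : Fin n → ℝ, q u ⬝ᵥ (A * e) =
      √(q u ⬝ᵥ (A * q u)) * (geodesicCurve A q u ⬝ᵥ e) := fun e => by
    rw [← mul_dotProduct_comm, h.mul_eq_smul_geodesicCurve hA hu, smul_dotProduct, smul_eq_mul,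
      ← h.mul_eq_smul_geodesicCurve hA hu]
  rw [← mul_dotProduct_comm A (f u), smul_dotProduct, dotProduct_smul, dotProduct_comm (A * f u),
    hXe (g u), hXe (f u)]
  simp only [smul_eq_mul]
  ring

end IsReducedSolution

/-! ### Spectral theorem on the orthogonal complement of two null vectors -/

/-- A symmetric S that annihilates u and v preserves their orthogonal complement, of dimension m;
its restriction there is diagonalized. -/
theorem exists_orthonormal_eigenvectors {m : ℕ} {S : Matrix (Fin (m + 2)) (Fin (m + 2)) ℝ}
    (hS : Sᵀ = S) {u v : Fin (m + 2) → ℝ} (hu : u ⬝ᵥ u = 1) (hv : v ⬝ᵥ v = 1) (huv : u ⬝ᵥ v = 0)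
    (hSu : S *ᵥ u = 0) (hSv : S *ᵥ v = 0) :
    ∃ (α : Fin m → ℝ) (N : Fin m → Fin (m + 2) → ℝ),
      (∀ i j, N i ⬝ᵥ N j = if i = j then 1 else 0) ∧ (∀ j, u ⬝ᵥ N j = 0) ∧
      (∀ j, v ⬝ᵥ N j = 0) ∧ ∀ j, S *ᵥ N j = α j • N j := by
  let E := EuclideanSpace ℝ (Fin (m + 2))
  have inner_eq : ∀ x y : E, inner ℝ x y = x.ofLp ⬝ᵥ y.ofLp := fun x y => by
    rw [EuclideanSpace.inner_eq_star_dotProduct, star_trivial, dotProduct_comm]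
  let T : E →ₗ[ℝ] E := toEuclideanLin S
  have hT : T.IsSymmetric := isSymmetric_toEuclideanLin_iff.2 <| by
    rw [IsHermitian, conjTranspose_eq_transpose_of_trivial, hS]
  have hTx : ∀ x : E, (T x).ofLp = S *ᵥ x.ofLp := fun x => rfl
  let w : Fin 2 → E := ![WithLp.toLp 2 u, WithLp.toLp 2 v]
  have hw : Orthonormal ℝ w := by
    rw [orthonormal_iff_ite]
    intro i j
    rw [inner_eq]
    fin_cases i <;> fin_cases j <;> simp [w, hu, hv, huv, dotProduct_comm v u]
  have hTw : ∀ i, T (w i) = 0 := fun i => by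
    refine WithLp.ofLp_injective 2 ?_
    rw [hTx]
    fin_cases i <;> simp [w, hSu, hSv]
  let V : Submodule ℝ E := (Submodule.span ℝ (Set.range w))ᗮ
  have hV : ∀ x : E, x ∈ V ↔ ∀ i, inner ℝ (w i) x = 0 := fun x => by
    refine ⟨fun hx i => (Submodule.mem_orthogonal _ _).1 hx _ (Submodule.subset_span ⟨i, rfl⟩),
      fun hx => (Submodule.mem_orthogonal _ _).2 fun y hy => ?_⟩
    induction hy using Submodule.span_induction with
    | mem y hy => obtain ⟨i, rfl⟩ := hy; exact hx i
    | zero => exact inner_zero_left _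
    | add y z _ _ hy hz => rw [inner_add_left, hy, hz, add_zero]
    | smul c y _ hy => rw [inner_smul_left, hy, mul_zero]
  have hTV : ∀ x ∈ V, T x ∈ V := fun x _ => (hV _).2 fun i => by
    rw [← hT, hTw, inner_zero_left]
  have hfin : Module.finrank ℝ V = m := by
    have h1 := Submodule.finrank_add_finrank_orthogonal (Submodule.span ℝ (Set.range w))
    rw [finrank_span_eq_card hw.linearIndependent, finrank_euclideanSpace_fin,
      Fintype.card_fin] at h1
    change 2 + Module.finrank ℝ V = m + 2 at h1
    omega
  have hTr := hT.restrict_invariant hTV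
  let b := hTr.eigenvectorBasis hfin
  refine ⟨hTr.eigenvalues hfin, fun j => (b j : E).ofLp, fun i j => ?_, fun j => ?_, fun j => ?_,
    fun j => ?_⟩
  · rw [← inner_eq, ← Submodule.coe_inner]
    exact orthonormal_iff_ite.1 b.orthonormal i j
  · have := (hV _).1 (b j).2 0
    rwa [inner_eq] at this
  · have := (hV _).1 (b j).2 1
    rwa [inner_eq] at this
  · have := congrArg (fun x : V => (x : E).ofLp) (hTr.apply_eigenvectorBasis hfin j)
    exact this

/-! ### The moving frame -/

section frame

variable {m : ℕ} {A : Fin (m + 2) → ℝ} {q : ℝ → Fin (m + 2) → ℝ}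
  {N : Fin m → ℝ → Fin (m + 2) → ℝ} {t : ℝ}

theorem frame_zero : frame A q N t 0 = q t := rfl

theorem frame_castSucc_succ (j : Fin m) : frame A q N t j.castSucc.succ = N j t :=
  Fin.snoc_castSucc (α := fun _ => Fin (m + 2) → ℝ) (gam A q t) (fun j => N j t) j

theorem frame_last_succ : frame A q N t (Fin.last m).succ = gam A q t :=
  Fin.snoc_last (α := fun _ => Fin (m + 2) → ℝ) (gam A q t) (fun j => N j t)

theorem last_succ_ne_castSucc_succ (j : Fin m) : (Fin.last m).succ ≠ j.castSucc.succ :=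
  (Fin.succ_injective _).ne (Fin.castSucc_lt_last j).ne'

theorem forall_frame_index {P : Fin (m + 2) → Prop} (h0 : P 0) (hN : ∀ j : Fin m, P j.castSucc.succ)
    (hl : P (Fin.last m).succ) (i : Fin (m + 2)) : P i := by
  refine Fin.cases h0 (fun i => ?_) i
  exact Fin.lastCases hl hN i

theorem frame_mul_transpose (hq : q t ⬝ᵥ q t = 1) (hγ : gam A q t ⬝ᵥ gam A q t = 1)
    (hqγ : q t ⬝ᵥ gam A q t = 0) (hN : ∀ i j, N i t ⬝ᵥ N j t = if i = j then 1 else 0)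
    (hqN : ∀ j, q t ⬝ᵥ N j t = 0) (hγN : ∀ j, gam A q t ⬝ᵥ N j t = 0) :
    frame A q N t * (frame A q N t)ᵀ = 1 := by
  ext i j
  rw [mul_transpose_apply_eq_dotProduct, one_apply]
  have h0 : ∀ i : Fin (m + 1), (0 : Fin (m + 2)) ≠ i.succ := fun i => (Fin.succ_ne_zero i).symm
  refine forall_frame_index (P := fun i => frame A q N t i ⬝ᵥ frame A q N t j =
    if i = j then 1 else 0) ?_ ?_ ?_ i
  · refine forall_frame_index (P := fun j => frame A q N t 0 ⬝ᵥ frame A q N t j =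
      if 0 = j then 1 else 0) ?_ ?_ ?_ j
    · rw [frame_zero, hq, if_pos rfl]
    · intro j; rw [frame_zero, frame_castSucc_succ, hqN, if_neg (h0 _)]
    · rw [frame_zero, frame_last_succ, hqγ, if_neg (h0 _)]
  · intro i
    refine forall_frame_index (P := fun j => frame A q N t i.castSucc.succ ⬝ᵥ frame A q N t j =
      if i.castSucc.succ = j then 1 else 0) ?_ ?_ ?_ j
    · rw [frame_zero, frame_castSucc_succ, dotProduct_comm, hqN, if_neg (h0 _).symm]
    · intro j
      rw [frame_castSucc_succ, frame_castSucc_succ, hN]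
      simp only [Fin.succ_inj, Fin.castSucc_inj]
    · rw [frame_last_succ, frame_castSucc_succ, dotProduct_comm, hγN,
        if_neg (last_succ_ne_castSucc_succ i).symm]
  · refine forall_frame_index (P := fun j => frame A q N t (Fin.last m).succ ⬝ᵥ frame A q N t j =
      if (Fin.last m).succ = j then 1 else 0) ?_ ?_ ?_ j
    · rw [frame_zero, frame_last_succ, dotProduct_comm, hqγ, if_neg (h0 _).symm]
    · intro j
      rw [frame_castSucc_succ, frame_last_succ, hγN, if_neg (last_succ_ne_castSucc_succ j)]
    · rw [frame_last_succ, hγ, if_pos rfl]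

theorem hasDerivAt_frame {ω : Matrix (Fin (m + 2)) (Fin (m + 2)) ℝ}
    (hq : HasDerivAt q (q t ᵥ* ω) t) (hγ : HasDerivAt (gam A q) (gam A q t ᵥ* ω) t)
    (hN : ∀ j, HasDerivAt (N j) (N j t ᵥ* ω) t) (i : Fin (m + 2)) :
    HasDerivAt (fun u => frame A q N u i) (frame A q N t i ᵥ* ω) t := by
  refine forall_frame_index (P := fun i =>
    HasDerivAt (fun u => frame A q N u i) (frame A q N t i ᵥ* ω) t) hq (fun j => ?_) ?_ i
  · simp only [frame_castSucc_succ]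
    exact hN j
  · simp only [frame_last_succ]
    exact hγ

theorem det_frame_update_neg (N : Fin m → Fin (m + 2) → ℝ) (k : Fin m) :
    (frame A q (fun j _ => Function.update N k (-N k) j) t).det =
      -(frame A q (fun j _ => N j) t).det := by
  have h : frame A q (fun j _ => Function.update N k (-N k) j) t =
      (frame A q (fun j _ => N j) t).updateRow k.castSucc.succ
        ((-1 : ℝ) • frame A q (fun j _ => N j) t k.castSucc.succ) := by
    funext i
    refine forall_frame_index (P := fun i =>
      frame A q (fun j _ => Function.update N k (-N k) j) t i =
      (frame A q (fun j _ => N j) t).updateRow k.castSucc.succ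
        ((-1 : ℝ) • frame A q (fun j _ => N j) t k.castSucc.succ) i) ?_ (fun j => ?_) ?_ i
    · rw [updateRow_ne (Fin.succ_ne_zero _).symm, frame_zero, frame_zero]
    · by_cases hjk : j = k
      · subst hjk
        rw [updateRow_self, frame_castSucc_succ, frame_castSucc_succ, Function.update_self,
          neg_one_smul]
      · rw [updateRow_ne (by simpa using hjk), frame_castSucc_succ, frame_castSucc_succ,
          Function.update_of_ne hjk]
    · rw [updateRow_ne (last_succ_ne_castSucc_succ k), frame_last_succ,
        frame_last_succ]
  rw [h, det_updateRow_smul, updateRow_eq_self, neg_one_mul]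

theorem charpoly_of_frame {S : Matrix (Fin (m + 2)) (Fin (m + 2)) ℝ} {α : Fin m → ℝ}
    (hF : frame A q N t * (frame A q N t)ᵀ = 1) (hq : S *ᵥ q t = 0) (hγ : S *ᵥ gam A q t = 0)
    (hN : ∀ j, S *ᵥ N j t = α j • N j t) :
    S.charpoly = Polynomial.X ^ 2 * ∏ j, (Polynomial.X - Polynomial.C (α j)) := by
  set F := frame A q N t with hFdef
  let d : Fin (m + 2) → ℝ := Fin.cons 0 (Fin.snoc (α := fun _ => ℝ) α 0)
  have hd : ∀ i, S *ᵥ F i = d i • F i := by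
    refine forall_frame_index ?_ (fun j => ?_) ?_
    · simp [hFdef, frame_zero, hq, d]
    · simp [hFdef, frame_castSucc_succ, hN, d]
    · have hdl : d (Fin.last m).succ = 0 := Fin.snoc_last (α := fun _ => ℝ) 0 α
      rw [hFdef, frame_last_succ, hγ, hdl, zero_smul]
  have h1 : S * Fᵀ = Fᵀ * diagonal d := by
    ext i j
    rw [mul_diagonal, transpose_apply, mul_comm]
    exact congrFun (hd j) i
  have h2 : S = Fᵀ * (diagonal d * F) := by
    rw [← Matrix.mul_assoc, ← h1, Matrix.mul_assoc, transpose_mul_of_mul_transpose hF,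
      Matrix.mul_one]
  rw [h2, charpoly_mul_comm, Matrix.mul_assoc, hF, Matrix.mul_one, charpoly_diagonal,
    Fin.prod_univ_succ, Fin.prod_univ_castSucc]
  simp [d]
  ring

/-- Eigenvectors for a simple nonzero eigenvalue are multiples of the frame vector. -/
theorem eq_smul_of_eigenvector {S : Matrix (Fin (m + 2)) (Fin (m + 2)) ℝ} {α : Fin m → ℝ}
    (hS : ∀ x y : Fin (m + 2) → ℝ, x ⬝ᵥ (S *ᵥ y) = (S *ᵥ x) ⬝ᵥ y)
    (hF : frame A q N t * (frame A q N t)ᵀ = 1) (hq : S *ᵥ q t = 0) (hγ : S *ᵥ gam A q t = 0)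
    (hN : ∀ j, S *ᵥ N j t = α j • N j t) (hα : Function.Injective α) {j : Fin m} (hj : α j ≠ 0)
    {y : Fin (m + 2) → ℝ} (hy : S *ᵥ y = α j • y) : y = (N j t ⬝ᵥ y) • N j t := by
  have hrow := dotProduct_row_of_mul_transpose hF
  -- Eigenvectors of a symmetric matrix for different eigenvalues are orthogonal. Since α j ≠ 0,
  -- this also covers q and γ, leaving y only its component along N j.
  have hz : ∀ x β, S *ᵥ x = β • x → β ≠ α j → x ⬝ᵥ y = 0 := fun x β hx hβ => by
    have := hS x y
    rw [hx, hy, dotProduct_smul, smul_dotProduct, smul_eq_mul, smul_eq_mul] at this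
    exact (mul_eq_zero.1 (show (α j - β) * (x ⬝ᵥ y) = 0 by linarith)).resolve_left
      (sub_ne_zero.2 hβ.symm)
  refine eq_of_dotProduct_row_eq hF (forall_frame_index ?_ (fun i => ?_) ?_)
  · have := hrow 0 j.castSucc.succ
    rw [frame_castSucc_succ, if_neg (Fin.succ_ne_zero _).symm] at this
    rw [dotProduct_smul, this, frame_zero, hz (q t) 0 (by rw [hq, zero_smul]) hj.symm, smul_zero]
  · have := hrow i.castSucc.succ j.castSucc.succ
    rw [frame_castSucc_succ, frame_castSucc_succ] at this
    rw [dotProduct_smul, frame_castSucc_succ, this]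
    by_cases hij : i = j
    · subst hij
      simp
    · rw [hz (N i t) (α i) (hN i) fun h => hij (hα h), if_neg (by simpa using hij), smul_zero]
  · have := hrow (Fin.last m).succ j.castSucc.succ
    rw [frame_castSucc_succ, frame_last_succ,
      if_neg (last_succ_ne_castSucc_succ j)] at this
    rw [dotProduct_smul, frame_last_succ, this, hz (gam A q t) 0 (by rw [hγ, zero_smul]) hj.symm,
      smul_zero]

theorem mem_SO_of_det_pos {n : ℕ} {g : Matrix (Fin n) (Fin n) ℝ} (hg : g * gᵀ = 1)
    (hd : 0 < g.det) : g ∈ specialOrthogonalGroup (Fin n) ℝ := by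
  refine mem_SO_iff.2 ⟨hg, ?_⟩
  have h := congrArg det hg
  rw [det_mul, det_transpose, det_one] at h
  nlinarith

end frame

/-! ### Rotations that fix the first basis vector -/

theorem mem_SO_iff_of_block {k : ℕ} {S : Matrix (Fin (k + 1)) (Fin (k + 1)) ℝ} (h00 : S 0 0 = 1)
    (h0 : ∀ j : Fin k, S 0 j.succ = 0) (h0' : ∀ i : Fin k, S i.succ 0 = 0) :
    S ∈ specialOrthogonalGroup (Fin (k + 1)) ℝ ↔
      S.submatrix Fin.succ Fin.succ ∈ specialOrthogonalGroup (Fin k) ℝ := by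
  have hdet : S.det = (S.submatrix Fin.succ Fin.succ).det := by
    rw [det_succ_row_zero, Fin.sum_univ_succ]
    simp [h00, h0]
  have hmul : ∀ i j : Fin k, (S * Sᵀ) i.succ j.succ =
      (S.submatrix Fin.succ Fin.succ * (S.submatrix Fin.succ Fin.succ)ᵀ) i j := fun i j => by
    simp [mul_apply, Fin.sum_univ_succ, h0']
  rw [mem_SO_iff, mem_SO_iff, hdet]
  refine and_congr_left fun _ => ⟨fun h => ?_, fun h => ?_⟩
  · ext i j
    rw [← hmul, h]
    simp [one_apply]
  · ext i j
    refine Fin.cases ?_ (fun i => ?_) i <;> refine Fin.cases ?_ (fun j => ?_) j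
    · simp [mul_apply, Fin.sum_univ_succ, h00, h0]
    · simp [mul_apply, Fin.sum_univ_succ, h00, h0, h0', (Fin.succ_ne_zero j).symm]
    · simp [mul_apply, Fin.sum_univ_succ, h00, h0, h0']
    · rw [hmul, h]
      simp [one_apply]

/-! ### The moving frame of eigenvectors -/

theorem continuousOn_det {n : ℕ} {I : Set ℝ} {g : ℝ → Matrix (Fin n) (Fin n) ℝ}
    (hg : ∀ i, ContinuousOn (fun t => g t i) I) : ContinuousOn (fun t => (g t).det) I := by
  simp only [det_apply']
  exact continuousOn_finsetSum _ fun σ _ => continuousOn_const.mul <|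
    continuousOn_finsetProd _ fun i _ => continuousOn_pi.1 (hg (σ i)) i

section orthonormal_frame

variable {m : ℕ} {A : Fin (m + 2) → ℝ} {q : ℝ → Fin (m + 2) → ℝ}
  {N : Fin m → ℝ → Fin (m + 2) → ℝ} {t : ℝ}

theorem dotProduct_normal_of_frame (hF : frame A q N t * (frame A q N t)ᵀ = 1) (i j : Fin m) :
    N i t ⬝ᵥ N j t = if i = j then 1 else 0 := by
  have := dotProduct_row_of_mul_transpose hF i.castSucc.succ j.castSucc.succ
  rw [frame_castSucc_succ, frame_castSucc_succ] at this
  rw [this]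
  simp only [Fin.succ_inj, Fin.castSucc_inj]

theorem dotProduct_q_normal_of_frame (hF : frame A q N t * (frame A q N t)ᵀ = 1) (j : Fin m) :
    q t ⬝ᵥ N j t = 0 := by
  have := dotProduct_row_of_mul_transpose hF 0 j.castSucc.succ
  rwa [frame_castSucc_succ, frame_zero, if_neg (Fin.succ_ne_zero _).symm] at this

theorem dotProduct_gam_normal_of_frame (hF : frame A q N t * (frame A q N t)ᵀ = 1) (j : Fin m) :
    gam A q t ⬝ᵥ N j t = 0 := by
  have := dotProduct_row_of_mul_transpose hF (Fin.last m).succ j.castSucc.succ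
  rwa [frame_castSucc_succ, frame_last_succ, if_neg (last_succ_ne_castSucc_succ j)] at this

end orthonormal_frame

/-- An orthonormal, positively oriented family of eigenvectors of `𝓛` with positive eigenvalues
that satisfies the kinematic equation. -/
structure IsTransportedFamily {m : ℕ} (A : Fin (m + 2) → ℝ) (I : Set ℝ)
    (q : ℝ → Fin (m + 2) → ℝ) (α : Fin m → ℝ) (N : Fin m → ℝ → Fin (m + 2) → ℝ) : Prop where
  hasDerivAt : ∀ t ∈ I, ∀ j, HasDerivAt (N j) (N j t ᵥ* wedge (q t) (deriv q t)) t
  orthonormal : ∀ t ∈ I, frame A q N t * (frame A q N t)ᵀ = 1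
  oriented : ∀ t ∈ I, 0 < (frame A q N t).det
  eigenvector : ∀ t ∈ I, ∀ j, laxCurve A q t *ᵥ N j t = α j • N j t
  pos : ∀ j, 0 < α j

namespace IsReducedSolution

variable {m : ℕ} {A : Fin (m + 2) → ℝ} {I : Set ℝ} {q p : ℝ → Fin (m + 2) → ℝ}

theorem exists_initial_family (h : IsReducedSolution A I q p) (hm : 0 < m) (hA : ∀ i, 0 < A i)
    {t : ℝ} (ht : t ∈ I) (hp : 0 < p t ⬝ᵥ p t) :
    ∃ (α : Fin m → ℝ) (N : Fin m → Fin (m + 2) → ℝ),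
      frame A q (fun j _ => N j) t * (frame A q (fun j _ => N j) t)ᵀ = 1 ∧
      0 < (frame A q (fun j _ => N j) t).det ∧ ∀ j, laxCurve A q t *ᵥ N j = α j • N j := by
  have hq := h.sphere t ht
  have hγ := h.dotProduct_gam_self hA ht hp
  have hqγ := h.dotProduct_gam hA ht
  obtain ⟨α, N, hN, hqN, hγN, hLN⟩ := exists_orthonormal_eigenvectors
    (transpose_laxMatrix A (geodesicCurve A q t) (gam A q t)) hq hγ hqγ
    (h.laxCurve_mulVec_q hA ht hp) (h.laxCurve_mulVec_gam hA ht hp)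
  have hF := frame_mul_transpose (A := A) (N := fun j _ => N j) hq hγ hqγ hN hqN hγN
  have hdet : (frame A q (fun j _ => N j) t).det ≠ 0 := fun h0 => by
    have := congrArg det hF
    rw [det_mul, h0, zero_mul, det_one] at this
    exact zero_ne_one this
  rcases hdet.lt_or_gt with hneg | hpos
  -- A wrong orientation is corrected by reversing one eigenvector, which exists because m > 0.
  · let k : Fin m := ⟨0, hm⟩
    have hupd : ∀ j, ∃ ε : ℝ, ε * ε = 1 ∧ Function.update N k (-N k) j = ε • N j := fun j => by
      by_cases hj : j = k
      · subst hj
        exact ⟨-1, by norm_num, by simp⟩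
      · exact ⟨1, by norm_num, by simp [hj]⟩
    choose ε hε hεN using hupd
    refine ⟨α, Function.update N k (-N k), frame_mul_transpose hq hγ hqγ (fun i j => ?_)
      (fun j => ?_) (fun j => ?_), ?_, fun j => ?_⟩
    · rw [hεN, hεN, dotProduct_smul, smul_dotProduct, hN]
      by_cases hij : i = j
      · subst hij
        simp [hε]
      · simp [hij]
    · rw [hεN, dotProduct_smul, hqN, smul_zero]
    · rw [hεN, dotProduct_smul, hγN, smul_zero]
    · rw [det_frame_update_neg]
      linarith
    · rw [hεN, mulVec_smul, smul_comm]
      exact congrArg (ε j • ·) (hLN j)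
  · exact ⟨α, N, hF, hpos, hLN⟩

theorem exists_transportedFamily (h : IsReducedSolution A I q p) (hm : 0 < m)
    (hA : ∀ i, 0 < A i) (hI : IsOpen I) (hI' : I.OrdConnected) {t₀ : ℝ} (ht₀ : t₀ ∈ I)
    (hp : ∀ t ∈ I, 0 < p t ⬝ᵥ p t) : ∃ α N, IsTransportedFamily A I q α N := by
  obtain ⟨α, N₀, hF₀, hdet₀, hL₀⟩ := h.exists_initial_family hm hA ht₀ (hp t₀ ht₀)
  have hskew : ∀ t ∈ I, (wedge (q t) (deriv q t))ᵀ = -wedge (q t) (deriv q t) :=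
    fun t _ => transpose_wedge _ _
  have hcont : ∀ i j, ContinuousOn (fun t => wedge (q t) (deriv q t) i j) I := by
    intro i j
    have h1 : ∀ i, ContinuousOn (fun t => q t i) I := fun i => continuousOn_pi.1
      (fun t ht => (h.hasDerivAt_q ht).continuousAt.continuousWithinAt) i
    have h2 : ∀ i, ContinuousOn (fun t => deriv q t i) I := fun i => continuousOn_pi.1
      (fun t ht => (h.differentiableAt_deriv_q hA hI ht).continuousAt.continuousWithinAt) i
    exact ((h1 i).mul (h2 j)).sub ((h2 i).mul (h1 j))
  choose N hN₀ hNd using fun j => exists_transported hI hI' ht₀ hskew hcont (N₀ j)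
  have hγd : ∀ t ∈ I, HasDerivAt (gam A q) (gam A q t ᵥ* wedge (q t) (deriv q t)) t :=
    fun t ht => h.transported_gam hA hI hI' ht
  have hqd : ∀ t ∈ I, HasDerivAt q (q t ᵥ* wedge (q t) (deriv q t)) t :=
    fun t ht => h.transported_q ht
  have hframe₀ : frame A q N t₀ = frame A q (fun j _ => N₀ j) t₀ := by
    simp only [frame, hN₀]
  have hFd : ∀ t ∈ I, ∀ i, HasDerivAt (fun u => frame A q N u i)
      (frame A q N t i ᵥ* wedge (q t) (deriv q t)) t := fun t ht =>
    hasDerivAt_frame (hqd t ht) (hγd t ht) fun j => hNd j t ht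
  have hF : ∀ t ∈ I, frame A q N t * (frame A q N t)ᵀ = 1 := fun t ht => by
    ext i j
    rw [mul_transpose_apply_eq_dotProduct, dotProduct_eq_of_transported hI hI' hskew
      (fun t ht => hFd t ht i) (fun t ht => hFd t ht j) ht ht₀,
      ← mul_transpose_apply_eq_dotProduct, hframe₀, hF₀]
  -- The determinant is continuous with square 1 on a connected set, so it keeps its initial sign.
  have hdet : ∀ t ∈ I, 0 < (frame A q N t).det := by
    have hc : ContinuousOn (fun t => (frame A q N t).det) I :=
      continuousOn_det fun i t ht => (hFd t ht i).continuousAt.continuousWithinAt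
    have hsq : Set.EqOn ((fun t => (frame A q N t).det) ^ 2) ((fun _ => (1 : ℝ)) ^ 2) I :=
      fun t ht => by
        have := congrArg det (hF t ht)
        rw [det_mul, det_transpose, det_one] at this
        simp only [Pi.pow_apply, sq, this, mul_one]
    have hpos₀ : 0 < (frame A q N t₀).det := by rwa [hframe₀]
    rcases hI'.isPreconnected.eq_or_eq_neg_of_sq_eq hc continuousOn_const hsq
      (fun _ => one_ne_zero) with h1 | h1
    · intro t ht
      have : (frame A q N t).det = 1 := h1 ht
      rw [this]
      exact one_pos
    · have : (frame A q N t₀).det = -1 := h1 ht₀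
      rw [this] at hpos₀
      linarith
  -- Tested against the frame: with q and γ both sides give 0 by symmetry of 𝓛, and with N i the
  -- matrix element equals its value at t₀.
  have heig : ∀ t ∈ I, ∀ j, laxCurve A q t *ᵥ N j t = α j • N j t := fun t ht j => by
    have hsymm := laxMatrix_symm A (geodesicCurve A q t) (gam A q t)
    refine eq_of_dotProduct_row_eq (hF t ht) (forall_frame_index ?_ (fun i => ?_) ?_)
    · rw [frame_zero, laxCurve, hsymm, ← laxCurve, h.laxCurve_mulVec_q hA ht (hp t ht),
        zero_dotProduct, dotProduct_smul, dotProduct_q_normal_of_frame (hF t ht), smul_zero]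
    · rw [frame_castSucc_succ, h.dotProduct_laxCurve_mulVec_eq hA hI hI' hp (hNd i) (hNd j)
        (fun t ht => dotProduct_q_normal_of_frame (hF t ht) i)
        (fun t ht => dotProduct_q_normal_of_frame (hF t ht) j)
        (fun t ht => dotProduct_gam_normal_of_frame (hF t ht) i)
        (fun t ht => dotProduct_gam_normal_of_frame (hF t ht) j) ht ht₀, hN₀ j, hL₀ j,
        ← hN₀ j, dotProduct_smul, dotProduct_smul, dotProduct_normal_of_frame (hF t ht),
        dotProduct_normal_of_frame (hF t₀ ht₀)]
    · rw [frame_last_succ, laxCurve, hsymm, ← laxCurve, h.laxCurve_mulVec_gam hA ht (hp t ht),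
        zero_dotProduct, dotProduct_smul, dotProduct_gam_normal_of_frame (hF t ht), smul_zero]
  refine ⟨α, N, fun t ht j => hNd j t ht, hF, hdet, heig, fun j => ?_⟩
  have hunit := dotProduct_normal_of_frame (hF t₀ ht₀) j j
  rw [if_pos rfl] at hunit
  have := h.dotProduct_laxCurve_pos hA ht₀ (hp t₀ ht₀) (ne_zero_of_dotProduct_self hunit)
    (dotProduct_q_normal_of_frame (hF t₀ ht₀) j) (dotProduct_gam_normal_of_frame (hF t₀ ht₀) j)
  rwa [heig t₀ ht₀, dotProduct_smul, hunit, smul_eq_mul, mul_one] at this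

theorem isLRSolution_of_transportedFamily (h : IsReducedSolution A I q p) (hA : ∀ i, 0 < A i)
    (hI : IsOpen I) (hI' : I.OrdConnected) {α : Fin m → ℝ} {N : Fin m → ℝ → Fin (m + 2) → ℝ}
    (hN : IsTransportedFamily A I q α N) :
    IsLRSolution A I (frame A q N) (fun t => wedge (q t) (deriv q t)) :=
  h.isLRSolution_of_transported hA hI
    (fun t ht => mem_SO_of_det_pos (hN.orthonormal t ht) (hN.oriented t ht)) (fun _ _ => rfl)
    fun t ht => hasDerivAt_frame (h.transported_q ht) (h.transported_gam hA hI hI' ht)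
      (hN.hasDerivAt t ht)

/-- For simple eigenvalues the eigenvectors of `𝓛` at one time are unique up to a factor. -/
theorem eq_smul_of_laxCurve_eigenvector (h : IsReducedSolution A I q p) (hA : ∀ i, 0 < A i)
    (hp : ∀ t ∈ I, 0 < p t ⬝ᵥ p t) {α : Fin m → ℝ} {N : Fin m → ℝ → Fin (m + 2) → ℝ}
    (hN : IsTransportedFamily A I q α N) (hα : Function.Injective α) {t : ℝ} (ht : t ∈ I)
    {j : Fin m} {y : Fin (m + 2) → ℝ} (hy : laxCurve A q t *ᵥ y = α j • y) :
    y = (N j t ⬝ᵥ y) • N j t :=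
  eq_smul_of_eigenvector (laxMatrix_symm _ _ _) (hN.orthonormal t ht)
    (h.laxCurve_mulVec_q hA ht (hp t ht)) (h.laxCurve_mulVec_gam hA ht (hp t ht))
    (hN.eigenvector t ht) hα (hN.pos j).ne' hy

/-- Simple eigenvalues give N j = εP j with ε = (P j, N j) continuous and ε² = 1. On the connected
set I the sign ε is constant, so the kinematic equation passes from P to N. -/
theorem isTransportedFamily_of_isNormalFamily (h : IsReducedSolution A I q p)
    (hA : ∀ i, 0 < A i) (hI : IsOpen I) (hI' : I.OrdConnected)
    (hp : ∀ t ∈ I, 0 < p t ⬝ᵥ p t) {α : Fin m → ℝ} {P N : Fin m → ℝ → Fin (m + 2) → ℝ}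
    (hP : IsTransportedFamily A I q α P) (hα : Function.Injective α)
    (hN : IsNormalFamily A I q α N) : IsTransportedFamily A I q α N := by
  have hNP : ∀ t ∈ I, ∀ j, N j t = (P j t ⬝ᵥ N j t) • P j t := fun t ht j =>
    h.eq_smul_of_laxCurve_eigenvector hA hp hP hα ht (hN.eigenvector t ht j)
  have hPP := fun t ht => dotProduct_normal_of_frame (hP.orthonormal t ht)
  have hsign : ∀ j, ∃ ε : ℝ, ε * ε = 1 ∧ ∀ t ∈ I, N j t = ε • P j t := fun j => by
    have hc : ContinuousOn (fun t => P j t ⬝ᵥ N j t) I := by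
      simp only [dotProduct]
      exact continuousOn_finsetSum _ fun i _ => (continuousOn_pi.1 (fun t ht =>
        (hP.hasDerivAt t ht j).continuousAt.continuousWithinAt) i).mul
          (continuousOn_pi.1 (hN.continuousOn j) i)
    have hsq : Set.EqOn ((fun t => P j t ⬝ᵥ N j t) ^ 2) ((fun _ => (1 : ℝ)) ^ 2) I :=
      fun t ht => by
        have h1 := hN.unit t ht j
        rw [hNP t ht j, dotProduct_smul, smul_dotProduct, hPP t ht, if_pos rfl] at h1
        simp only [smul_eq_mul, mul_one] at h1
        simp only [Pi.pow_apply, sq, h1, mul_one]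
    rcases hI'.isPreconnected.eq_or_eq_neg_of_sq_eq hc continuousOn_const hsq
      (fun _ => one_ne_zero) with h1 | h1
    · refine ⟨1, by norm_num, fun t ht => ?_⟩
      have : P j t ⬝ᵥ N j t = 1 := h1 ht
      rw [hNP t ht j, this]
    · refine ⟨-1, by norm_num, fun t ht => ?_⟩
      have : P j t ⬝ᵥ N j t = -1 := h1 ht
      rw [hNP t ht j, this]
  choose ε hε hεN using hsign
  refine ⟨fun t ht j => ?_, fun t ht => ?_, hN.oriented, hN.eigenvector, hP.pos⟩
  · rw [hεN j t ht, smul_vecMul]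
    refine ((hP.hasDerivAt t ht j).const_smul (ε j)).congr_of_eventuallyEq ?_
    filter_upwards [hI.mem_nhds ht] with s hs using hεN j s hs
  · refine frame_mul_transpose (h.sphere t ht) (h.dotProduct_gam_self hA ht (hp t ht))
      (h.dotProduct_gam hA ht) (fun i j => ?_) (fun j => ?_) (fun j => ?_)
    · rw [hεN i t ht, hεN j t ht, dotProduct_smul, smul_dotProduct, hPP t ht]
      by_cases hij : i = j
      · subst hij
        simp [hε]
      · simp [hij]
    · rw [hεN j t ht, dotProduct_smul, dotProduct_q_normal_of_frame (hP.orthonormal t ht),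
        smul_zero]
    · rw [hεN j t ht, dotProduct_smul, dotProduct_gam_normal_of_frame (hP.orthonormal t ht),
        smul_zero]

end IsReducedSolution

/-! ### All solutions over a reduced trajectory -/

theorem IsLRSolution.congr_omega {k : ℕ} {A : Fin (k + 1) → ℝ} {I : Set ℝ} (hI : IsOpen I)
    {g ω ω' : ℝ → Matrix (Fin (k + 1)) (Fin (k + 1)) ℝ} (h : IsLRSolution A I g ω)
    (hω : ∀ t ∈ I, ω' t = ω t) : IsLRSolution A I g ω' where
  mem_SO := h.mem_SO
  kinematic t ht := by rw [hω t ht]; exact h.kinematic t ht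
  constraint t ht := by rw [hω t ht]; exact h.constraint t ht
  dynamic t ht := by
    obtain ⟨lam, hlam⟩ := h.dynamic t ht
    refine ⟨lam, fun i j => ?_⟩
    rw [hω t ht]
    refine (hlam i j).congr_of_eventuallyEq ?_
    filter_upwards [hI.mem_nhds ht] with s hs
    rw [hω s hs]

namespace IsReducedSolution

variable {k : ℕ} {A : Fin (k + 1) → ℝ} {I : Set ℝ} {q p : ℝ → Fin (k + 1) → ℝ}
  {f g ω : ℝ → Matrix (Fin (k + 1)) (Fin (k + 1)) ℝ}

/-- The scalar products of the rows of f and g are conserved, so the transition matrix at t₀ serves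
for all times. The common first vector makes it a block matrix, and R is its lower block. -/
theorem exists_rotation_of_isLRSolution (hI : IsOpen I) (hI' : I.OrdConnected) {t₀ : ℝ}
    (ht₀ : t₀ ∈ I) (hf : IsLRSolution A I f ω) (hg : IsLRSolution A I g ω)
    (h0 : ∀ t ∈ I, g t 0 = f t 0) :
    ∃ R ∈ specialOrthogonalGroup (Fin k) ℝ, ∀ t ∈ I, ∀ j : Fin k,
      g t j.succ = ∑ i : Fin k, R i j • f t i.succ := by
  set S := f t₀ * (g t₀)ᵀ with hS
  have hSij : ∀ i j, S i j = f t₀ i ⬝ᵥ g t₀ j := fun i j => rfl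
  have hfo := dotProduct_row_of_mul_transpose (hf.mul_transpose ht₀)
  have hgo := dotProduct_row_of_mul_transpose (hg.mul_transpose ht₀)
  have hSO : S ∈ specialOrthogonalGroup (Fin (k + 1)) ℝ := by
    refine mem_SO_iff.2 ⟨?_, ?_⟩
    · rw [hS, transpose_mul, transpose_transpose, Matrix.mul_assoc, ← Matrix.mul_assoc (g t₀)ᵀ,
        transpose_mul_of_mul_transpose (hg.mul_transpose ht₀), Matrix.one_mul,
        hf.mul_transpose ht₀]
    · rw [hS, det_mul, det_transpose, (mem_SO_iff.1 (hf.mem_SO t₀ ht₀)).2,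
        (mem_SO_iff.1 (hg.mem_SO t₀ ht₀)).2, one_mul]
  refine ⟨S.submatrix Fin.succ Fin.succ, (mem_SO_iff_of_block ?_ ?_ ?_).1 hSO, fun t ht j => ?_⟩
  · rw [hSij, h0 t₀ ht₀, hfo, if_pos rfl]
  · intro j
    rw [hSij, ← h0 t₀ ht₀, hgo, if_neg (Fin.succ_ne_zero j).symm]
  · intro i
    rw [hSij, h0 t₀ ht₀, hfo, if_neg (Fin.succ_ne_zero i)]
  · have hexp := eq_sum_dotProduct_row (hf.mul_transpose ht) (g t j.succ)
    have hz : f t 0 ⬝ᵥ g t j.succ = 0 := by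
      rw [← h0 t ht, dotProduct_row_of_mul_transpose (hg.mul_transpose ht),
        if_neg (Fin.succ_ne_zero j).symm]
    rw [Fin.sum_univ_succ, hz, zero_smul, zero_add] at hexp
    rw [hexp]
    refine Finset.sum_congr rfl fun i _ => ?_
    rw [submatrix_apply, hSij, dotProduct_eq_of_transported hI hI' (fun t ht => hf.skew hI ht)
      (fun t ht => hf.hasDerivAt_row ht i.succ) (fun t ht => hg.hasDerivAt_row ht j.succ) ht ht₀]

/-- Constant linear combinations of transported vectors are transported, and a rotation of the frame
keeps it in SO(n). -/
theorem isLRSolution_of_rotation (h : IsReducedSolution A I q p) (hA : ∀ i, 0 < A i)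
    (hI : IsOpen I) (hf : IsLRSolution A I f fun t => wedge (q t) (deriv q t))
    (hf0 : ∀ t ∈ I, f t 0 = q t) (hg0 : ∀ t ∈ I, g t 0 = q t) {R : Matrix (Fin k) (Fin k) ℝ}
    (hR : R ∈ specialOrthogonalGroup (Fin k) ℝ)
    (hgR : ∀ t ∈ I, ∀ j : Fin k, g t j.succ = ∑ i : Fin k, R i j • f t i.succ) :
    IsLRSolution A I g fun t => wedge (q t) (deriv q t) := by
  let S : Matrix (Fin (k + 1)) (Fin (k + 1)) ℝ :=
    Matrix.of (Fin.cons (Fin.cons 1 0) fun i => Fin.cons 0 (R i))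
  have hSR : S.submatrix Fin.succ Fin.succ = R := rfl
  have hSO : S ∈ specialOrthogonalGroup (Fin (k + 1)) ℝ :=
    (mem_SO_iff_of_block rfl (fun _ => rfl) fun _ => rfl).2 (hSR ▸ hR)
  have hrow : ∀ t ∈ I, ∀ j, g t j = ∑ i, S i j • f t i := fun t ht j => by
    rw [Fin.sum_univ_succ]
    refine Fin.cases ?_ (fun j => ?_) j
    · simp [S, hg0 t ht, hf0 t ht]
    · simp [S, hgR t ht]
  have hgS : ∀ t ∈ I, g t = Sᵀ * f t := fun t ht => by
    ext i j
    rw [hrow t ht i, Finset.sum_apply, mul_apply]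
    rfl
  obtain ⟨hS1, hS2⟩ := mem_SO_iff.1 hSO
  refine h.isLRSolution_of_transported hA hI (fun t ht => ?_) hg0 fun t ht j => ?_
  · rw [hgS t ht, mem_SO_iff, transpose_mul, transpose_transpose, det_mul, det_transpose, hS2,
      (mem_SO_iff.1 (hf.mem_SO t ht)).2, Matrix.mul_assoc, ← Matrix.mul_assoc (f t),
      hf.mul_transpose ht, Matrix.one_mul, transpose_mul_of_mul_transpose hS1]
    exact ⟨rfl, one_mul 1⟩
  · have h1 : HasDerivAt (fun u => ∑ i, S i j • f u i)
        (∑ i, S i j • (f t i ᵥ* wedge (q t) (deriv q t))) t :=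
      HasDerivAt.fun_sum fun i _ => (hf.hasDerivAt_row ht i).fun_const_smul (S i j)
    rw [hrow t ht j, sum_vecMul]
    simp only [smul_vecMul]
    refine h1.congr_of_eventuallyEq ?_
    filter_upwards [hI.mem_nhds ht] with s hs using hrow s hs j

/-- The constraint fixes ω once e_1 = q is given, so all solutions over the trajectory obey one
linear equation. Conversely, -ωq = q̇ makes the momentum condition automatic. -/
theorem isLRSolution_and_projectsTo_iff (h : IsReducedSolution A I q p) (hA : ∀ i, 0 < A i)
    (hI : IsOpen I) (hI' : I.OrdConnected) {t₀ : ℝ} (ht₀ : t₀ ∈ I)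
    (hf : IsLRSolution A I f fun t => wedge (q t) (deriv q t)) (hf0 : ∀ t ∈ I, f t 0 = q t) :
    (IsLRSolution A I g ω ∧ ProjectsTo A I g ω q p) ↔
      ((∀ t ∈ I, ω t = wedge (q t) (deriv q t) ∧ g t 0 = q t) ∧
        ∃ R ∈ specialOrthogonalGroup (Fin k) ℝ, ∀ t ∈ I, ∀ j : Fin k,
          g t j.succ = ∑ i : Fin k, R i j • f t i.succ) := by
  constructor
  · rintro ⟨hg, hgp⟩
    have hg0 : ∀ t ∈ I, g t 0 = q t := fun t ht => (hgp t ht).1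
    have hω : ∀ t ∈ I, ω t = wedge (q t) (deriv q t) := fun t ht =>
      hg.omega_eq_wedge_deriv hI hg0 ht
    exact ⟨fun t ht => ⟨hω t ht, hg0 t ht⟩, exists_rotation_of_isLRSolution hI hI' ht₀ hf
      (hg.congr_omega hI fun t ht => (hω t ht).symm) fun t ht => by rw [hg0 t ht, hf0 t ht]⟩
  · rintro ⟨hω, R, hR, hgR⟩
    refine ⟨(h.isLRSolution_of_rotation hA hI hf hf0 (fun t ht => (hω t ht).2) hR hgR).congr_omega
      hI fun t ht => (hω t ht).1, fun t ht => ⟨(hω t ht).2, ?_⟩⟩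
    rw [(hω t ht).1, (hω t ht).2, wedge_mulVec, h.sphere t ht, dotProduct_comm,
      h.dotProduct_deriv ht, zero_smul, one_smul, zero_sub, neg_neg, h.momentum_deriv hA ht]

end IsReducedSolution

end Veselova

end

theorem mainTheorem4 (m : ℕ) (hm : 0 < m) (A : Fin (m + 2) → ℝ) (hA : ∀ i, 0 < A i)
    (I : Set ℝ) (hI : IsOpen I) (hI' : I.OrdConnected)
    (q p : ℝ → Fin (m + 2) → ℝ) (hqp : Veselova.IsReducedSolution A I q p)
    (t₀ : ℝ) (ht₀ : t₀ ∈ I) (hp : p t₀ ≠ 0) :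
    -- `X` is a geodesic on `Q(0)`, and its arc length is related to the time by the energy `h`
    Veselova.IsGeodesicOn A 0 I (Veselova.geodesicCurve A q) ∧
    (∃ h : ℝ, 0 < h ∧ ∀ t ∈ I, Veselova.reducedLagrangian A (q t) (deriv q t) = h ∧
      √(deriv (Veselova.geodesicCurve A q) t ⬝ᵥ deriv (Veselova.geodesicCurve A q) t) =
        √((Veselova.geodesicCurve A q t ⬝ᵥ (A⁻¹ ^ 2 * Veselova.geodesicCurve A q t)) /
          (Veselova.gam A q t ⬝ᵥ (A⁻¹ * Veselova.gam A q t))) *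
        √(Veselova.detA A * (2 * h / ((A * q t) ⬝ᵥ q t)))) ∧
    -- the constants of motion `α_2, …, α_{n-1}`
    ∃ α : Fin m → ℝ,
      (∀ t ∈ I, (Veselova.laxCurve A q t).charpoly =
        Polynomial.X ^ 2 * ∏ j, (Polynomial.X - Polynomial.C (α j))) ∧
      -- some moving frame `(q, 𝔫_2, …, 𝔫_{n-1}, γ)` is a solution with `ω = q ∧ q̇`
      (∃ N, Veselova.IsNormalFamily A I q α N ∧
        Veselova.IsLRSolution A I (Veselova.frame A q N)
          (fun t => Veselova.wedge (q t) (deriv q t))) ∧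
      -- in the generic case every such frame is one, and the `𝔫_k` are normal to the `Q(α_k)`
      -- at the touching points of the tangent line of `X`
      (Function.Injective α → ∀ N, Veselova.IsNormalFamily A I q α N →
        Veselova.IsLRSolution A I (Veselova.frame A q N)
          (fun t => Veselova.wedge (q t) (deriv q t)) ∧
        ∀ j, (∀ i, α j ≠ A i) → ∀ t ∈ I,
          (∃ y w, Veselova.TouchesAt A (α j) (Veselova.geodesicCurve A q t)
            (Veselova.gam A q t) y w) ∧
          ∀ y w, Veselova.TouchesAt A (α j) (Veselova.geodesicCurve A q t)
            (Veselova.gam A q t) y w → ∃ c : ℝ, N j t = c • Veselova.quadricNormal A (α j) y) ∧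
      -- all solutions over the same reduced trajectory
      (∀ N, Veselova.IsNormalFamily A I q α N →
        Veselova.IsLRSolution A I (Veselova.frame A q N)
          (fun t => Veselova.wedge (q t) (deriv q t)) →
        ∀ g ω : ℝ → Matrix (Fin (m + 2)) (Fin (m + 2)) ℝ,
          (Veselova.IsLRSolution A I g ω ∧ Veselova.ProjectsTo A I g ω q p) ↔
          ((∀ t ∈ I, ω t = Veselova.wedge (q t) (deriv q t) ∧ g t 0 = q t) ∧
            ∃ R ∈ Matrix.specialOrthogonalGroup (Fin (m + 1)) ℝ, ∀ t ∈ I, ∀ j : Fin (m + 1),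
              g t j.succ = ∑ i : Fin (m + 1), R i j • Veselova.frame A q N t i.succ)) := by
  have hpp : ∀ t ∈ I, 0 < p t ⬝ᵥ p t := fun t ht => hqp.dotProduct_p_self_pos hI hI' ht₀ hp ht
  obtain ⟨α, P, hP⟩ := hqp.exists_transportedFamily hm hA hI hI' ht₀ hpp
  refine ⟨hqp.isGeodesicOn hA hI hI' hpp,
    ⟨Veselova.reducedLagrangian A (q t₀) (deriv q t₀), ?_, fun t ht =>
      ⟨hqp.reducedLagrangian_const hA hI hI' ht ht₀, ?_⟩⟩,
    α, fun t ht => Veselova.charpoly_of_frame (hP.orthonormal t ht)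
      (hqp.laxCurve_mulVec_q hA ht (hpp t ht)) (hqp.laxCurve_mulVec_gam hA ht (hpp t ht))
      (hP.eigenvector t ht),
    ⟨P, ⟨fun j t ht => (hP.hasDerivAt t ht j).continuousAt.continuousWithinAt, fun t ht j => ?_,
      hP.eigenvector, hP.oriented⟩, hqp.isLRSolution_of_transportedFamily hA hI hI' hP⟩,
    fun hα N hN => ?_, fun N _ hLR g ω =>
      hqp.isLRSolution_and_projectsTo_iff hA hI hI' ht₀ hLR fun _ _ => rfl⟩
  · rw [hqp.reducedLagrangian_eq hA ht₀]
    have h1 := Veselova.dotProduct_mul_self_pos (A := A⁻¹) (fun i => inv_pos.2 (hA i)) hp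
    have h2 := hqp.inner_pos hA ht₀
    have h3 := Veselova.detA_pos hA
    positivity
  · rw [hqp.speed_eq hA ht (hpp t ht), hqp.reducedLagrangian_const hA hI hI' ht ht₀]
  · rw [Veselova.dotProduct_normal_of_frame (hP.orthonormal t ht), if_pos rfl]
  · have hNt := hqp.isTransportedFamily_of_isNormalFamily hA hI hI' hpp hP hα hN
    refine ⟨hqp.isLRSolution_of_transportedFamily hA hI hI' hNt, fun j hj t ht => ?_⟩
    have hγ := hqp.dotProduct_gam_self hA ht (hpp t ht)
    have hF := hNt.orthonormal t ht
    refine ⟨Veselova.exists_touchesAt_of_eigenvector hj hγ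
      (Veselova.ne_zero_of_dotProduct_self (hN.unit t ht j))
      (Veselova.dotProduct_gam_normal_of_frame hF j) (hN.eigenvector t ht j), fun y w hy => ?_⟩
    -- The normal at any touching point is a nonzero eigenvector for the simple eigenvalue α j,
    -- hence a nonzero multiple of N j; the required factor is the inverse.
    have h1 := hqp.eq_smul_of_laxCurve_eigenvector hA hpp hNt hα ht
      (Veselova.laxMatrix_mulVec_quadricNormal hj hγ hy)
    set c := N j t ⬝ᵥ Veselova.quadricNormal A (α j) y
    have hc : c ≠ 0 := fun h0 => hy.quadricNormal_ne_zero hj (by rw [h1, h0, zero_smul])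
    exact ⟨c⁻¹, by rw [h1, smul_smul, inv_mul_cancel₀ hc, one_smul]⟩
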